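/- **Theorem (relative entropy bound for the linear advection-diffusion equation).** Let $\Omega=(0,1)$, $T>0$, $\varepsilon>0$, $b\in\mathbb R$. Equip $H^1_0(\Omega)$ with the norm $\|\partial_x\phi\|_{L^2(\Omega)}$ and its dual $H^{-1}(\Omega)$ with the dual norm. Let $g_D\in W^{1,\infty}((0,T)\times\partial\Omega)$, that is, a Lipschitz function of time at each of the two end points of $\Omega$. Let $u_0\in H^1(\Omega)$ and let $u\in L^\infty((0,T)\times\Omega)\cap L^2(0,T;H^1(\Omega))$ be an entropy solution of $$\partial_t u+b\,\partial_x u=\varepsilon\,\partial_{xx}u$$ for the entropy/entropy-flux pair $\eta(u)=\tfrac12u^2$, $q(u)=\tfrac b2u^2$, with initial data $u_0$; that is, $$\int_0^T\!\!\int_\Omega \partial_t\phi\,u+\partial_x\phi\,(bu-\varepsilon\partial_xu)\,dx\,dt+\int_\Omega u_0\,\phi(0,\cdot)\,dx=0$$ for all $\phi\in C_c^\infty([0,T)\times\Omega)$, and $$\int_0^T\!\!\int_\Omega \partial_t\Phi\,\eta(u)+\partial_x\Phi\,\big(q(u)-\varepsilon\,u\,\partial_xu\big)-\varepsilon\,\Phi\,(\partial_xu)^2\,dx\,dt+\int_\Omega\Phi(0,\cdot)\,\eta(u_0)\,dx\ge0$$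 for all $\Phi\in C_c^\infty([0,T)\times\Omega)$ with $\Phi\ge0$. Assume that the trace of $u(t,\cdot)$ on $\partial\Omega$ is $g_D(t,\cdot)$ for almost every $t\in(0,T)$. Let $r_1\in L^1(0,T;L^2(\Omega))$, $r_2\in L^2(0,T;H^{-1}(\Omega))$ and $\widehat u_0\in W^{1,\infty}(\Omega)$, and let $\widehat u\in W^{1,\infty}((0,T)\times\Omega)$ (taken Lipschitz continuous on $[0,T]\times\overline\Omega$) be a weak solution of $$\partial_t\widehat u+b\,\partial_x\widehat u=\varepsilon\,\partial_{xx}\widehat u+r_1+\varepsilon r_2$$ with $\widehat u(0,\cdot)=\widehat u_0$ and with the same boundary data $g_D$; that is, $$\int_0^T\!\!\int_\Omega \partial_t\phi\,\widehat u+\partial_x\phi\,(b\widehat u-\varepsilon\partial_x\widehat u)+r_1\phi\,dx\,dt+\varepsilon\int_0^T\langle r_2(t),\phi(t,\cdot)\rangle\,dt+\int_\Omega\widehat u(0,\cdot)\,\phi(0,\cdot)\,dx=0$$ for all $\phi\in C_c^\infty([0,T)\times\Omega)$. Then for almost all $t\in(0,T)$ $$\tfrac14\|u-\widehat u\|_{L^\infty(0,t;L^2(\Omega))}^2+\tfrac\varepsilon2\|\partial_x(u-\widehat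 u)\|_{L^2((0,t)\times\Omega)}^2\le\|u_0-\widehat u_0\|_{L^2(\Omega)}^2+4\|r_1\|_{L^1(0,t;L^2(\Omega))}^2+\varepsilon\|r_2\|_{L^2(0,t;H^{-1}(\Omega))}^2 .$$ -/

import Mathlib

open Set MeasureTheory
open scoped ENNReal NNReal

noncomputable section

namespace AdvDiff

/-! ### Domain, time interval, space-time cylinder -/

/-- The spatial domain, the open unit interval. -/
abbrev Om : Set ℝ := Ioo 0 1

/-- Lebesgue measure on the spatial domain. -/
abbrev muOm : Measure ℝ := volume.restrict Om

/-- Lebesgue measure on the time interval `(0, t)`. -/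
abbrev muTime (t : ℝ) : Measure ℝ := volume.restrict (Ioo 0 t)

/-- Lebesgue measure on the space-time cylinder `(0, t) × (0, 1)`; points are `(time, space)`. -/
abbrev muCyl (t : ℝ) : Measure (ℝ × ℝ) := volume.restrict (Ioo 0 t ×ˢ Om)

/-! ### Test functions on the spatial domain, and the space `H⁻¹` -/

/-- Smooth functions with compact support in `(0, 1)`, as a linear subspace of all functions. -/
def testSubmodule : Submodule ℝ (ℝ → ℝ) where
  carrier := {φ | ContDiff ℝ (⊤ : ℕ∞) φ ∧ HasCompactSupport φ ∧ tsupport φ ⊆ Om}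
  add_mem' := by
    rintro φ ψ ⟨h1, h2, h3⟩ ⟨k1, k2, k3⟩
    exact ⟨h1.add k1, h2.add k2, (tsupport_add φ ψ).trans (union_subset h3 k3)⟩
  zero_mem' := ⟨contDiff_const, HasCompactSupport.zero, by simp [tsupport]⟩
  smul_mem' := by
    rintro c φ ⟨h1, h2, h3⟩
    refine ⟨contDiff_const.smul h1, ?_, ?_⟩
    · exact h2.smul_left (f := fun _ => c)
    · exact (tsupport_smul_subset_right (fun _ => c) φ).trans h3

/-- The space `C_c^∞(0, 1)`. -/
def TestFn : Type := testSubmodule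

instance : AddCommGroup TestFn := inferInstanceAs (AddCommGroup testSubmodule)

instance : Module ℝ TestFn := inferInstanceAs (Module ℝ testSubmodule)

instance : CoeFun TestFn (fun _ => ℝ → ℝ) := ⟨fun φ => φ.1⟩

theorem TestFn.contDiff (φ : TestFn) : ContDiff ℝ (⊤ : ℕ∞) (φ : ℝ → ℝ) := φ.2.1

theorem TestFn.memLp_deriv (φ : TestFn) : MemLp (deriv (φ : ℝ → ℝ)) 2 muOm :=
  ((φ.contDiff.continuous_deriv (by simp)).memLp_of_hasCompactSupport φ.2.2.1.deriv).restrict _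

/-- The map `φ ↦ φ'` from `C_c^∞(0, 1)` to `L²(0, 1)`. -/
def TestFn.grad : TestFn →ₗ[ℝ] Lp ℝ 2 muOm where
  toFun φ := φ.memLp_deriv.toLp _
  map_add' φ ψ := by
    rw [← MemLp.toLp_add]
    refine MemLp.toLp_congr _ _ (Filter.Eventually.of_forall fun x => ?_)
    exact deriv_add (φ.contDiff.differentiable (by simp) x) (ψ.contDiff.differentiable (by simp) x)
  map_smul' c φ := by
    rw [RingHom.id_apply, ← MemLp.toLp_const_smul]
    refine MemLp.toLp_congr _ _ (Filter.Eventually.of_forall fun x => ?_)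
    exact deriv_const_smul c (φ.contDiff.differentiable (by simp) x)

/-- `C_c^∞(0, 1)` carries the norm of `H¹₀(0, 1)`, that is `‖φ‖ = ‖φ'‖_{L²(0,1)}`. -/
instance : SeminormedAddCommGroup TestFn :=
  SeminormedAddCommGroup.induced TestFn (Lp ℝ 2 muOm) TestFn.grad

instance : NormedSpace ℝ TestFn := NormedSpace.induced ℝ TestFn (Lp ℝ 2 muOm) TestFn.grad

/-- `H⁻¹(0, 1)`: the distributions on `(0, 1)` which are bounded for the norm `‖φ'‖_{L²}`, with
the dual norm. As `C_c^∞(0, 1)` is dense in `H¹₀(0, 1)`, this is the dual of `H¹₀(0, 1)`. -/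
abbrev HNegOne : Type := TestFn →L[ℝ] ℝ

/-! ### Test functions on `[0, T) × (0, 1)` -/

/-- `C_c^∞([0, T) × (0, 1))`: such functions are the restrictions to nonnegative times of smooth
functions on the plane with compact support in `(-∞, T) × (0, 1)`. In particular they need not
vanish at time `0`. -/
structure CylTest (T : ℝ) where
  toFun : ℝ → ℝ → ℝ
  smooth : ContDiff ℝ (⊤ : ℕ∞) (Function.uncurry toFun)
  compact : HasCompactSupport (Function.uncurry toFun)
  supp : tsupport (Function.uncurry toFun) ⊆ Iio T ×ˢ Om

instance (T : ℝ) : CoeFun (CylTest T) (fun _ => ℝ → ℝ → ℝ) := ⟨CylTest.toFun⟩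

theorem CylTest.tsupport_slice {T : ℝ} (φ : CylTest T) (t : ℝ) :
    tsupport (φ t) ⊆ (fun x => (t, x)) ⁻¹' tsupport (Function.uncurry φ.toFun) :=
  closure_minimal (fun _ hx => subset_tsupport _ hx)
    ((isClosed_tsupport _).preimage (by fun_prop))

/-- The slice `φ(t, ·)`, a test function on `(0, 1)`. -/
def CylTest.slice {T : ℝ} (φ : CylTest T) (t : ℝ) : TestFn :=
  ⟨φ t, φ.smooth.comp (contDiff_const.prodMk contDiff_id),
    (φ.compact.image continuous_snd).of_isClosed_subset (isClosed_tsupport _)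
      (fun x hx => ⟨(t, x), φ.tsupport_slice t hx, rfl⟩),
    fun _ hx => (φ.supp (φ.tsupport_slice t hx)).2⟩

/-- `∂_t φ`. -/
def CylTest.dt {T : ℝ} (φ : CylTest T) (t x : ℝ) : ℝ := deriv (fun s => φ s x) t

/-- `∂_x φ`. -/
def CylTest.dx {T : ℝ} (φ : CylTest T) (t x : ℝ) : ℝ := deriv (φ t) x

/-! ### Function spaces -/

/-- `v` and `v'` are in `L¹(0, 1)` and `v'` is the weak derivative of `v` on `(0, 1)`. -/
structure IsWeakDeriv (v v' : ℝ → ℝ) : Prop where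
  integrable : Integrable v muOm
  integrable_deriv : Integrable v' muOm
  integral_eq : ∀ ψ : TestFn,
    ∫ x in Om, v x * deriv (ψ : ℝ → ℝ) x = - ∫ x in Om, v' x * ψ x

/-- `v ∈ H¹(0, 1)`. -/
def MemH1 (v : ℝ → ℝ) : Prop :=
  MemLp v 2 muOm ∧ ∃ v' : ℝ → ℝ, MemLp v' 2 muOm ∧ IsWeakDeriv v v'

/-- `∂_x v = vx` in the weak sense on `(0, 1)`, at almost every time in `(0, T)`. -/
def IsWeakDerivX (T : ℝ) (v vx : ℝ → ℝ → ℝ) : Prop :=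
  ∀ᵐ t ∂(muTime T), IsWeakDeriv (v t) (vx t)

/-- `v ∈ L²(0, T; H¹(0, 1))`, with weak space derivative `vx`. -/
structure MemL2H1 (T : ℝ) (v vx : ℝ → ℝ → ℝ) : Prop where
  memLp : MemLp (Function.uncurry v) 2 (muCyl T)
  memLp_dx : MemLp (Function.uncurry vx) 2 (muCyl T)
  weakDeriv : IsWeakDerivX T v vx

/-- `v` is Lipschitz continuous on `s`. On a compact interval or rectangle these are the functions
of class `W^{1,∞}` on the interior, taken in their continuous representative. -/
def IsLip {X : Type*} [PseudoEMetricSpace X] (v : X → ℝ) (s : Set X) : Prop :=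
  ∃ K : ℝ≥0, LipschitzOnWith K v s

/-- `v ∈ W^{1,∞}((0, T) × (0, 1))` in its Lipschitz continuous representative on the closed
cylinder, with weak space derivative `vx`. -/
structure MemW1Inf (T : ℝ) (v vx : ℝ → ℝ → ℝ) : Prop where
  lipschitz : IsLip (Function.uncurry v) (Icc 0 T ×ˢ Icc 0 1)
  memLp_dx : MemLp (Function.uncurry vx) ∞ (muCyl T)
  weakDeriv : IsWeakDerivX T v vx

/-- The norm of `L^p(0, t; L²(0, 1))`. -/
def normLpL2 (p : ℝ≥0∞) (t : ℝ) (w : ℝ → ℝ → ℝ) : ℝ≥0∞ :=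
  eLpNorm (fun s => eLpNorm (w s) 2 muOm) p (muTime t)

/-- `r ∈ L¹(0, T; L²(0, 1))`. -/
structure MemL1L2 (T : ℝ) (r : ℝ → ℝ → ℝ) : Prop where
  aestronglyMeasurable : AEStronglyMeasurable (Function.uncurry r) (muCyl T)
  norm_lt_top : normLpL2 1 T r < ∞

/-- The trace of `v` on the boundary of `(0, 1)`: the values at `0` and `1` of the continuous
representative of `v` are `a₀` and `a₁`. -/
def HasTrace (v : ℝ → ℝ) (a₀ a₁ : ℝ) : Prop :=
  ∃ w : ℝ → ℝ, ContinuousOn w (Icc 0 1) ∧ v =ᵐ[muOm] w ∧ w 0 = a₀ ∧ w 1 = a₁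

/-- `v` has Dirichlet boundary data `g₀` at `x = 0` and `g₁` at `x = 1`, on `(0, T)`. -/
def HasDirichletData (T : ℝ) (v : ℝ → ℝ → ℝ) (g₀ g₁ : ℝ → ℝ) : Prop :=
  ∀ᵐ t ∂(muTime T), HasTrace (v t) (g₀ t) (g₁ t)

/-! ### The equations -/

/-- For `ε > 0`: `u` (with weak space derivative `ux`) is a weak solution of `∂_t u + b ∂_x u = ε ∂_xx u` on
`(0, T) × (0, 1)` with initial data `u₀`. -/
structure IsWeakSolution (ε b T : ℝ) (u₀ : ℝ → ℝ) (u ux : ℝ → ℝ → ℝ) : Prop where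
  bounded : MemLp (Function.uncurry u) ∞ (muCyl T)
  weakDeriv : IsWeakDerivX T u ux
  integrable_flux : Integrable (fun z : ℝ × ℝ => ε * ux z.1 z.2) (muCyl T)
  equation : ∀ φ : CylTest T,
    (∫ z, (φ.dt z.1 z.2 * u z.1 z.2
        + φ.dx z.1 z.2 * (b * u z.1 z.2 - ε * ux z.1 z.2)) ∂(muCyl T))
      + ∫ x in Om, u₀ x * φ 0 x = 0

/-- Weak solutions of `∂_t u + b ∂_x u = ε ∂_xx u` that satisfy the entropy inequality for the
entropy/entropy-flux pair `(η, q)`. The further requirement that the entropy dissipation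
`ε η''(u) (∂_x u)²` lie in `W^{-1,1}` is not listed: for `η` of class `C²`, bounded `u` and
`∂_x u ∈ L²` this product is in `L¹`. -/
structure IsEntropySolution (ε b : ℝ) (η q : ℝ → ℝ) (T : ℝ) (u₀ : ℝ → ℝ) (u ux : ℝ → ℝ → ℝ) :
    Prop extends IsWeakSolution ε b T u₀ u ux where
  entropy_ineq : ∀ Φ : CylTest T, (∀ t x, 0 ≤ Φ t x) →
    0 ≤ (∫ z, (Φ.dt z.1 z.2 * η (u z.1 z.2)
          + Φ.dx z.1 z.2 * (q (u z.1 z.2) - ε * (deriv η (u z.1 z.2) * ux z.1 z.2))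
          - ε * (Φ z.1 z.2 * (deriv (deriv η) (u z.1 z.2) * ux z.1 z.2 * ux z.1 z.2)))
          ∂(muCyl T))
      + ∫ x in Om, Φ 0 x * η (u₀ x)

/-- `v` (with weak space derivative `vx`) solves `∂_t v + b ∂_x v = ε ∂_xx v + r₁ + ε r₂` on
`(0, T) × (0, 1)` in the weak sense, with its initial values `v(0, ·)`. -/
def IsPerturbedSolution (ε b T : ℝ) (v vx r₁ : ℝ → ℝ → ℝ) (r₂ : ℝ → HNegOne) : Prop :=
  ∀ φ : CylTest T,
    (∫ z, (φ.dt z.1 z.2 * v z.1 z.2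
        + φ.dx z.1 z.2 * (b * v z.1 z.2 - ε * vx z.1 z.2)
        + r₁ z.1 z.2 * φ z.1 z.2) ∂(muCyl T))
      + ε * (∫ t in Ioo 0 T, r₂ t (φ.slice t))
      + ∫ x in Om, v 0 x * φ 0 x = 0

end AdvDiff

end

namespace AdvDiff

open Filter Topology

/-! The difference `w` of the two solutions vanishes on the boundary and solves the same equation
with source `-r₁ - ε r₂`. Formally, testing with `w` itself kills the convection term, since `∫ w
∂_x w = 0`, and gives `½ d/dt ‖w‖² + ε ‖∂_x w‖² ≤ ‖r₁‖ ‖w‖ + ε ‖r₂‖ ‖∂_x w‖`. Young's inequality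
spends half of the dissipation on the last term. Integrating in time and absorbing the supremum of
`‖w‖` yields the bound.

As `w` is not an admissible test function and has no time derivative in a classical sense, the
testing is carried out mode by mode. By `exists_seq_tendsto_sin` the function `sin (n π x)` may be
used as a test function. Each sine coefficient of `w` then solves a scalar initial value problem
weakly, so it is a primitive (`ae_eq_primitive_of_weak`) and its square can be differentiated
(`sq_sinCoeff_eq`). The zero trace turns `n π` times a sine coefficient of `w` into a cosine
coefficient of `∂_x w` (`IsWeakDeriv.cosCoeff_eq`), so the unbounded factors disappear and only
products of square-summable sequences remain. The functional `r₂` takes part through an `L²`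
representative of no larger norm (`HNegOne.exists_representation`).

Parseval's identities and dominated convergence let the finite sets of modes exhaust `ℤ`, which
proves the energy inequality `energy_le`. The passage to the stated norms is
`IsHomogeneousSolution.norm_le`. -/

/-! ### Calculus on an interval: primitives and weak initial value problems. -/

/-- A smooth compactly supported function with vanishing integral has a primitive of the same
kind. -/
theorem exists_testFn_primitive {g : ℝ → ℝ} (hg : ContDiff ℝ (⊤ : ℕ∞) g)
    (hc : HasCompactSupport g) {U : Set ℝ} (hU : U.OrdConnected) (hs : tsupport g ⊆ U)
    (h0 : ∫ x, g x = 0) :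
    ∃ G : ℝ → ℝ, ContDiff ℝ (⊤ : ℕ∞) G ∧ HasCompactSupport G ∧ tsupport G ⊆ U ∧
      ∀ x, HasDerivAt G (g x) x := by
  rcases (tsupport g).eq_empty_or_nonempty with he | hne
  · have hg0 : g = 0 := by
      rwa [tsupport_eq_empty_iff] at he
    refine ⟨0, contDiff_const, HasCompactSupport.zero, by simp [tsupport], fun x => ?_⟩
    rw [hg0]
    exact hasDerivAt_const x (0 : ℝ)
  set K := tsupport g with hK
  have hKc : IsCompact K := hc
  set a := sInf K
  set b := sSup K
  have ha : a ∈ K := hKc.sInf_mem hne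
  have hb : b ∈ K := hKc.sSup_mem hne
  have hsub : K ⊆ Icc a b := fun x hx => ⟨csInf_le hKc.bddBelow hx, le_csSup hKc.bddAbove hx⟩
  have hgz : ∀ x, x ∉ Icc a b → g x = 0 := fun x hx =>
    image_eq_zero_of_notMem_tsupport fun h => hx (hsub h)
  -- Starting strictly to the left of the support puts all of it into the half-open interval of
  -- integration, so that beyond `b` the integral is the full one, which vanishes.
  set G : ℝ → ℝ := fun x => ∫ t in (a - 1)..x, g t with hG
  have hder : ∀ x, HasDerivAt G (g x) x := fun x =>
    hg.continuous.integral_hasStrictDerivAt (a - 1) x |>.hasDerivAt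
  have hsuppG : Function.support G ⊆ Icc a b := by
    intro x hx
    by_contra hxn
    apply hx
    rcases lt_or_ge x a with h | h
    · rw [hG]
      apply intervalIntegral.integral_zero_ae
      refine Eventually.of_forall fun t ht => hgz t fun h' => ?_
      rw [mem_uIoc] at ht
      have := h'.1
      rcases ht with ⟨_, h2⟩ | ⟨_, h2⟩ <;> linarith
    · have hbx : b < x := by
        by_contra h'
        exact hxn ⟨h, not_lt.1 h'⟩
      change ∫ t in (a - 1)..x, g t = 0
      rw [intervalIntegral.integral_eq_integral_of_support_subset, h0]
      intro t ht
      have := hsub (subset_tsupport _ ht)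
      exact ⟨by linarith [this.1], by linarith [this.2]⟩
  have hts : tsupport G ⊆ Icc a b := closure_minimal hsuppG isClosed_Icc
  refine ⟨G, ?_, isCompact_Icc.of_isClosed_subset (isClosed_tsupport _) hts,
    hts.trans ((hU.out (hs ha) (hs hb))), hder⟩
  rw [contDiff_infty_iff_deriv]
  refine ⟨fun x => (hder x).differentiableAt, ?_⟩
  rwa [show deriv G = g from funext fun x => (hder x).deriv]

/-- Integration by parts for absolutely continuous functions. -/
theorem integral_deriv_mul_add {F G f g : ℝ → ℝ} {a b : ℝ}
    (hF : AbsolutelyContinuousOnInterval F a b)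
    (hf : ∀ᵐ x, x ∈ uIcc a b → HasDerivAt F (f x) x)
    (hG : AbsolutelyContinuousOnInterval G a b)
    (hg : ∀ᵐ x, x ∈ uIcc a b → HasDerivAt G (g x) x) :
    ∫ x in a..b, (f x * G x + F x * g x) = F b * G b - F a * G a := by
  rw [← hF.integral_deriv_mul_eq_sub hG]
  apply intervalIntegral.integral_congr_ae
  filter_upwards [hf, hg] with x h1 h2 h3
  rw [(h1 (uIoc_subset_uIcc h3)).deriv, (h2 (uIoc_subset_uIcc h3)).deriv]

/-- The primitive of `f` with value `c` at `a`. -/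
noncomputable def primitive (f : ℝ → ℝ) (c a x : ℝ) : ℝ := c + ∫ t in a..x, f t

theorem primitive_self (f : ℝ → ℝ) (c a : ℝ) : primitive f c a a = c := by simp [primitive]

theorem absolutelyContinuousOnInterval_primitive {f : ℝ → ℝ} {a b : ℝ}
    (hf : IntervalIntegrable f volume a b) (c : ℝ) :
    AbsolutelyContinuousOnInterval (primitive f c a) a b := by
  have h1 := hf.absolutelyContinuousOnInterval_intervalIntegral (c := a) (by simp)
  have h2 : AbsolutelyContinuousOnInterval (fun _ : ℝ => c) a b :=
    (contDiff_const (n := 1)).contDiffOn.absolutelyContinuousOnInterval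
  exact h2.add h1

theorem ae_hasDerivAt_primitive {f : ℝ → ℝ} {a b : ℝ}
    (hf : IntervalIntegrable f volume a b) (c : ℝ) :
    ∀ᵐ x, x ∈ uIcc a b → HasDerivAt (primitive f c a) (f x) x := by
  filter_upwards [hf.ae_hasDerivAt_integral] with x hx hx'
  exact (hx hx' a (by simp)).const_add c

theorem continuousOn_primitive {f : ℝ → ℝ} {a b : ℝ}
    (hf : IntervalIntegrable f volume a b) (c : ℝ) :
    ContinuousOn (primitive f c a) (uIcc a b) :=
  (absolutelyContinuousOnInterval_primitive hf c).continuousOn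

/-- Integration by parts for a primitive and a `C¹` function. -/
theorem integral_primitive_mul_contDiff {f G : ℝ → ℝ} {a b : ℝ}
    (hf : IntervalIntegrable f volume a b) (c : ℝ) (hG : ContDiff ℝ 1 G) :
    ∫ x in a..b, (f x * G x + primitive f c a x * deriv G x)
      = primitive f c a b * G b - c * G a := by
  have := integral_deriv_mul_add (absolutelyContinuousOnInterval_primitive hf c)
    (ae_hasDerivAt_primitive hf c) (hG.contDiffOn.absolutelyContinuousOnInterval)
    (Eventually.of_forall fun x _ => ((hG.differentiable one_ne_zero) x).hasDerivAt)
  rwa [primitive_self] at this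

/-- The square of a primitive. -/
theorem sq_primitive {f : ℝ → ℝ} {a b : ℝ}
    (hf : IntervalIntegrable f volume a b) (c : ℝ) :
    primitive f c a b ^ 2 = c ^ 2 + 2 * ∫ x in a..b, primitive f c a x * f x := by
  have := integral_deriv_mul_add (absolutelyContinuousOnInterval_primitive hf c)
    (ae_hasDerivAt_primitive hf c) (absolutelyContinuousOnInterval_primitive hf c)
    (ae_hasDerivAt_primitive hf c)
  rw [primitive_self] at this
  rw [← intervalIntegral.integral_const_mul, sq, sq, ← sub_eq_iff_eq_add', ← this]
  congr 1
  ext x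
  ring

theorem intervalIntegrable_of_Ioo {f : ℝ → ℝ} {a b : ℝ} (hab : a ≤ b)
    (hf : IntegrableOn f (Ioo a b)) : IntervalIntegrable f volume a b := by
  rwa [intervalIntegrable_iff_integrableOn_Ioo_of_le hab]

theorem integral_Ioo_eq_interval {f : ℝ → ℝ} {a b : ℝ} (hab : a ≤ b) :
    ∫ x in Ioo a b, f x = ∫ x in a..b, f x := by
  rw [intervalIntegral.integral_of_le hab, integral_Ioc_eq_integral_Ioo]

/-- The fundamental lemma of the calculus of variations on an open interval. -/
theorem ae_eq_of_forall_integral_mul_eq {f h : ℝ → ℝ} {a b : ℝ}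
    (hf : IntegrableOn f (Ioo a b)) (hh : IntegrableOn h (Ioo a b))
    (H : ∀ χ : ℝ → ℝ, ContDiff ℝ (⊤ : ℕ∞) χ → HasCompactSupport χ → tsupport χ ⊆ Ioo a b →
      ∫ x in Ioo a b, χ x * (f x - h x) = 0) :
    f =ᵐ[volume.restrict (Ioo a b)] h := by
  have := isOpen_Ioo.ae_eq_zero_of_integral_contDiff_smul_eq_zero
    (μ := (volume : Measure ℝ)) (f := fun x => f x - h x) (U := Ioo a b)
    (hf.sub hh).locallyIntegrableOn (fun g hg hgc hgs => by
      rw [← H g hg hgc hgs, setIntegral_eq_integral_of_forall_compl_eq_zero]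
      · rfl
      · intro x hx
        rw [image_eq_zero_of_notMem_tsupport fun h => hx (hgs h), zero_mul])
  rw [Filter.EventuallyEq, ae_restrict_iff' measurableSet_Ioo]
  filter_upwards [this] with x hx hx'
  linarith [hx hx']

/-- Weak solutions of a scalar initial value problem are primitives. -/
theorem ae_eq_primitive_of_weak {T : ℝ} (hT : 0 < T) {α F : ℝ → ℝ} {c : ℝ}
    (hα : IntegrableOn α (Ioo 0 T)) (hF : IntegrableOn F (Ioo 0 T))
    (H : ∀ θ : ℝ → ℝ, ContDiff ℝ (⊤ : ℕ∞) θ → HasCompactSupport θ → tsupport θ ⊆ Iio T →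
      (∫ t in Ioo 0 T, (deriv θ t * α t + θ t * F t)) + θ 0 * c = 0) :
    α =ᵐ[muTime T] primitive F c 0 := by
  have hFi := intervalIntegrable_of_Ioo hT.le hF
  have hAc : ContinuousOn (primitive F c 0) (Icc 0 T) := by
    simpa [uIcc_of_le hT.le] using continuousOn_primitive hFi c
  have hA : IntegrableOn (primitive F c 0) (Ioo 0 T) :=
    (hAc.integrableOn_compact isCompact_Icc).mono_set Ioo_subset_Icc_self
  refine ae_eq_of_forall_integral_mul_eq hα hA fun χ hχ hχc hχs => ?_
  have hsh : HasCompactSupport fun s => χ (s + T) := hχc.comp_homeomorph (Homeomorph.addRight T)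
  have hshs : tsupport (fun s => χ (s + T)) ⊆ Ioo (-T) T := by
    intro s hs
    have : s + T ∈ tsupport χ :=
      (tsupport_comp_subset_preimage χ (f := fun s => s + T) (by fun_prop)) hs
    have := hχs this
    exact ⟨by linarith [this.1], by linarith [this.2]⟩
  have hsm : ContDiff ℝ (⊤ : ℕ∞) fun s => χ (s + T) := hχ.comp (contDiff_id.add contDiff_const)
  -- The mean value of `χ` is compensated by a translate living at negative times. Hence `θ' = -χ`
  -- on `(0, T)` and `θ T = 0`, while `θ 0` is free and sees the initial value.
  obtain ⟨θ, hθ, hθc, hθs, hθd⟩ := exists_testFn_primitive (g := fun s => χ (s + T) - χ s)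
    (hsm.sub hχ) (hsh.sub hχc) (U := Ioo (-T) T) ordConnected_Ioo
    ((tsupport_sub _ _).trans (union_subset hshs (hχs.trans (Ioo_subset_Ioo_left (by linarith)))))
    (by
      rw [integral_sub (hsm.continuous.integrable_of_hasCompactSupport hsh)
        (hχ.continuous.integrable_of_hasCompactSupport hχc),
        integral_add_right_eq_self (fun s => χ s), sub_self])
  have h1 := H θ hθ hθc (hθs.trans fun x hx => hx.2)
  have h2 := integral_primitive_mul_contDiff hFi c (hθ.of_le (by exact_mod_cast le_top) : ContDiff ℝ 1 θ)
  have hθT : θ T = 0 := image_eq_zero_of_notMem_tsupport fun h => lt_irrefl T (hθs h).2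
  rw [hθT, mul_zero, zero_sub, ← integral_Ioo_eq_interval hT.le] at h2
  have hθb : ∃ C, ∀ x, ‖θ x‖ ≤ C := hθc.exists_bound_of_continuous hθ.continuous
  have hdc : Continuous (deriv θ) := hθ.continuous_deriv (by simp)
  have hdb : ∃ C, ∀ x, ‖deriv θ x‖ ≤ C := hθc.deriv.exists_bound_of_continuous hdc
  obtain ⟨C, hC⟩ := hθb
  obtain ⟨D, hD⟩ := hdb
  have i1 : IntegrableOn (fun t => θ t * F t) (Ioo 0 T) :=
    hF.bdd_mul hθ.continuous.aestronglyMeasurable (Eventually.of_forall hC)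
  have i2 : IntegrableOn (fun t => deriv θ t * α t) (Ioo 0 T) :=
    hα.bdd_mul hdc.aestronglyMeasurable (Eventually.of_forall hD)
  have i3 : IntegrableOn (fun t => deriv θ t * primitive F c 0 t) (Ioo 0 T) :=
    hA.bdd_mul hdc.aestronglyMeasurable (Eventually.of_forall hD)
  rw [integral_add i2 i1] at h1
  rw [show (fun x => F x * θ x + primitive F c 0 x * deriv θ x)
    = fun x => θ x * F x + deriv θ x * primitive F c 0 x by ext x; ring, integral_add i1 i3] at h2
  have h3 : ∫ x in Ioo 0 T, χ x * (α x - primitive F c 0 x)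
      = ∫ x in Ioo 0 T, (deriv θ x * primitive F c 0 x - deriv θ x * α x) := by
    refine setIntegral_congr_fun measurableSet_Ioo fun x hx => ?_
    have : χ (x + T) = 0 :=
      image_eq_zero_of_notMem_tsupport fun h => by linarith [(hχs h).2, hx.1]
    simp only [(hθd x).deriv, this]
    ring
  rw [h3, integral_sub i3 i2]
  linarith

/-! ### Sine and cosine series on the unit interval. -/

/-- The sine coefficients of a function on `(0, 1)`. -/
noncomputable def sinCoeff (f : ℝ → ℝ) (n : ℤ) : ℝ := ∫ x in Om, f x * Real.sin (n * Real.pi * x)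

/-- The cosine coefficients of a function on `(0, 1)`. -/
noncomputable def cosCoeff (f : ℝ → ℝ) (n : ℤ) : ℝ := ∫ x in Om, f x * Real.cos (n * Real.pi * x)

theorem hasSum_congr_both {f g : ℤ → ℝ} {a b : ℝ} (h : ∀ n, f n = g n) (hab : a = b) :
    HasSum f a ↔ HasSum g b := by
  rw [hab, funext h]

/-- Reflection folds `(-1, 0)` onto `(0, 1)`. With exponential kernels, the odd extension (`σ = -1`)
produces sines and the even one (`σ = 1`) cosines. -/
theorem integral_symm_extension {f : ℝ → ℝ} (hf : Integrable f muOm) (σ : ℝ) {k : ℝ → ℂ}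
    (hk : Continuous k) :
    ∫ x in (-1 : ℝ)..1, k x * ((Om.indicator f x + σ * Om.indicator f (-x) : ℝ) : ℂ)
      = ∫ x in Om, (k x + σ * k (-x)) * (f x : ℂ) := by
  have he : Integrable (Om.indicator f) := (integrable_indicator_iff measurableSet_Ioo).2 hf
  have hec : Integrable (fun x => ((Om.indicator f x : ℝ) : ℂ)) := he.ofReal
  have hen : Integrable (fun x => ((Om.indicator f (-x) : ℝ) : ℂ)) := hec.comp_neg
  have i1 : ∀ {k : ℝ → ℂ}, Continuous k →
      IntervalIntegrable (fun x => k x * ((Om.indicator f x : ℝ) : ℂ)) volume (-1) 1 :=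
    fun hk => hec.intervalIntegrable.continuousOn_mul hk.continuousOn
  have i2 : IntervalIntegrable (fun x => k x * ((Om.indicator f (-x) : ℝ) : ℂ)) volume (-1) 1 :=
    hen.intervalIntegrable.continuousOn_mul hk.continuousOn
  have e2 : ∫ x in (-1 : ℝ)..1, k x * ((Om.indicator f (-x) : ℝ) : ℂ)
      = ∫ x in (-1 : ℝ)..1, k (-x) * ((Om.indicator f x : ℝ) : ℂ) := by
    have := intervalIntegral.integral_comp_neg (a := -1) (b := 1)
      (fun x => k (-x) * ((Om.indicator f x : ℝ) : ℂ))
    simpa using this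
  have e1 : ∫ x in (-1 : ℝ)..1, k x * ((Om.indicator f x + σ * Om.indicator f (-x) : ℝ) : ℂ)
      = (∫ x in (-1 : ℝ)..1, k x * ((Om.indicator f x : ℝ) : ℂ))
        + σ * ∫ x in (-1 : ℝ)..1, k x * ((Om.indicator f (-x) : ℝ) : ℂ) := by
    rw [← intervalIntegral.integral_const_mul, ← intervalIntegral.integral_add (i1 hk)
      (i2.const_mul _)]
    congr 1
    ext x
    push_cast
    ring
  rw [e1, e2, ← intervalIntegral.integral_const_mul, ← intervalIntegral.integral_add (i1 hk)
    ((i1 (k := fun x => k (-x)) (hk.comp continuous_neg)).const_mul _),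
    intervalIntegral.integral_of_le (by norm_num)]
  have : (fun x => k x * ((Om.indicator f x : ℝ) : ℂ)
      + σ * (k (-x) * ((Om.indicator f x : ℝ) : ℂ)))
      = Om.indicator fun x => (k x + σ * k (-x)) * (f x : ℂ) := by
    ext x
    by_cases hx : x ∈ Om
    · simp only [indicator_of_mem hx]
      ring
    · simp [indicator_of_notMem hx]
  have hsub : Om ⊆ Ioc (-1) 1 := fun x hx => ⟨by linarith [hx.1], hx.2.le⟩
  rw [this, setIntegral_indicator measurableSet_Ioo, inter_eq_right.2 hsub]

/-- The function and its reflection have disjoint supports, so there is no cross term. The factor 2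
cancels the length of `(-1, 1)` in Parseval's identity. -/
theorem integral_sq_symm_extension {f : ℝ → ℝ} (hf : MemLp f 2 muOm) {σ : ℝ} (hσ : σ ^ 2 = 1) :
    ∫ x in (-1 : ℝ)..1, (Om.indicator f x + σ * Om.indicator f (-x)) ^ 2
      = 2 * ∫ x in Om, f x ^ 2 := by
  have hf2 : Integrable (fun x => f x ^ 2) muOm := hf.integrable_sq
  have := integral_symm_extension hf2 1 (k := fun _ => (1 : ℂ)) continuous_const
  have h2 : ∀ x, (Om.indicator f x + σ * Om.indicator f (-x)) ^ 2
      = Om.indicator (fun x => f x ^ 2) x + 1 * Om.indicator (fun x => f x ^ 2) (-x) := by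
    intro x
    by_cases hx : x ∈ Om
    · have : -x ∉ Om := fun h => by linarith [h.1, hx.1]
      simp [indicator_of_mem hx, indicator_of_notMem this]
    · by_cases hx' : -x ∈ Om
      · simp [indicator_of_notMem hx, indicator_of_mem hx', mul_pow, hσ]
      · simp [indicator_of_notMem hx, indicator_of_notMem hx']
  simp_rw [h2]
  simp only [one_mul, Complex.ofReal_one] at this ⊢
  rw [intervalIntegral.integral_ofReal, integral_const_mul, integral_complex_ofReal] at this
  apply Complex.ofReal_injective
  rw [this]
  push_cast
  ring

theorem memLp_symm_extension {f : ℝ → ℝ} (hf : MemLp f 2 muOm) (σ : ℝ) :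
    MemLp (fun x => Om.indicator f x + σ * Om.indicator f (-x)) 2 := by
  have he : MemLp (Om.indicator f) 2 := (memLp_indicator_iff_restrict measurableSet_Ioo).2 hf
  exact he.add ((he.comp_measurePreserving (Measure.measurePreserving_neg volume)).const_mul σ)

theorem integrable_of_memLp {f : ℝ → ℝ} (hf : MemLp f 2 muOm) : Integrable f muOm :=
  hf.integrable one_le_two

theorem fourierCoeffOn_symm_extension {f : ℝ → ℝ} (hf : MemLp f 2 muOm) (σ : ℝ) (n : ℤ) :
    fourierCoeffOn (by norm_num : (-1 : ℝ) < 1)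
        (fun x => ((Om.indicator f x + σ * Om.indicator f (-x) : ℝ) : ℂ)) n
      = (1 / 2 : ℂ) * ∫ x in Om, (Complex.exp (-(n * Real.pi * x * Complex.I))
          + σ * Complex.exp (n * Real.pi * x * Complex.I)) * (f x : ℂ) := by
  rw [fourierCoeffOn_eq_integral]
  have := integral_symm_extension (integrable_of_memLp hf) σ
    (k := fun x => Complex.exp (-(n * Real.pi * x * Complex.I))) (by fun_prop)
  push_cast at this
  simp only [mul_neg, neg_mul, neg_neg] at this
  rw [← this]
  rw [Complex.real_smul]
  push_cast
  congr 1
  · norm_num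
  refine intervalIntegral.integral_congr fun x _ => ?_
  simp only [smul_eq_mul]
  congr 1
  rw [fourier_coe_apply]
  congr 1
  push_cast
  ring

/-- Parseval's identity for the sine series on `(0, 1)`, summed over all integers. -/
theorem hasSum_sinCoeff_sq {f : ℝ → ℝ} (hf : MemLp f 2 muOm) :
    HasSum (fun n => sinCoeff f n ^ 2) (∫ x in Om, f x ^ 2) := by
  have h := hasSum_sq_fourierCoeffOn (by norm_num : (-1 : ℝ) < 1)
    (((memLp_symm_extension hf (-1)).ofReal (K := ℂ)).restrict _)
  refine (hasSum_congr_both ?_ ?_).2 h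
  · intro n
    have : fourierCoeffOn (by norm_num : (-1 : ℝ) < 1)
        (fun x => ((Om.indicator f x + (-1) * Om.indicator f (-x) : ℝ) : ℂ)) n
        = -Complex.I * (sinCoeff f n : ℂ) := by
      rw [fourierCoeffOn_symm_extension hf, sinCoeff, ← integral_complex_ofReal,
        ← integral_const_mul, ← integral_const_mul]
      congr 1
      ext x
      push_cast
      rw [Complex.sin]
      ring_nf
      simp only [Complex.I_sq]
      ring
    simp only [RCLike.ofReal_eq_complex_ofReal]
    rw [this]
    simp
  · have := integral_sq_symm_extension hf (σ := -1) (by norm_num)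
    simp only [RCLike.norm_ofReal, sq_abs]
    rw [this]
    norm_num
    ring

/-- Parseval's identity for the cosine series on `(0, 1)`, summed over all integers. -/
theorem hasSum_cosCoeff_sq {f : ℝ → ℝ} (hf : MemLp f 2 muOm) :
    HasSum (fun n => cosCoeff f n ^ 2) (∫ x in Om, f x ^ 2) := by
  have h := hasSum_sq_fourierCoeffOn (by norm_num : (-1 : ℝ) < 1)
    (((memLp_symm_extension hf 1).ofReal (K := ℂ)).restrict _)
  refine (hasSum_congr_both ?_ ?_).2 h
  · intro n
    have : fourierCoeffOn (by norm_num : (-1 : ℝ) < 1)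
        (fun x => ((Om.indicator f x + 1 * Om.indicator f (-x) : ℝ) : ℂ)) n
        = (cosCoeff f n : ℂ) := by
      rw [fourierCoeffOn_symm_extension hf, cosCoeff, ← integral_complex_ofReal,
        ← integral_const_mul]
      congr 1
      ext x
      push_cast
      rw [Complex.cos]
      ring_nf
    simp only [RCLike.ofReal_eq_complex_ofReal]
    rw [this]
    simp
  · have := integral_sq_symm_extension hf (σ := 1) (by norm_num)
    simp only [RCLike.norm_ofReal, sq_abs]
    rw [this]
    norm_num
    ring

theorem memLp_of_continuous {f : ℝ → ℝ} (hf : Continuous f) (p : ℝ≥0∞) : MemLp f p muOm := by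
  obtain ⟨C, hC⟩ := isCompact_Icc.exists_bound_of_continuousOn (hf.continuousOn (s := Icc 0 1))
  refine MemLp.of_bound hf.aestronglyMeasurable C ?_
  filter_upwards [ae_restrict_mem measurableSet_Ioo] with x hx
  exact hC x (Ioo_subset_Icc_self hx)

theorem integrable_mul_continuous {f g : ℝ → ℝ} (hf : Integrable f muOm) (hg : Continuous g) :
    Integrable (fun x => f x * g x) muOm := by
  obtain ⟨C, hC⟩ := isCompact_Icc.exists_bound_of_continuousOn (hg.continuousOn (s := Icc 0 1))
  refine hf.mul_bdd (c := C) hg.aestronglyMeasurable ?_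
  filter_upwards [ae_restrict_mem measurableSet_Ioo] with x hx
  exact hC x (Ioo_subset_Icc_self hx)

theorem cosCoeff_add {f g : ℝ → ℝ} (hf : Integrable f muOm) (hg : Integrable g muOm) (n : ℤ) :
    cosCoeff (fun x => f x + g x) n = cosCoeff f n + cosCoeff g n := by
  rw [cosCoeff, cosCoeff, cosCoeff, ← integral_add (integrable_mul_continuous hf (by fun_prop))
    (integrable_mul_continuous hg (by fun_prop))]
  congr 1
  ext x
  ring

theorem cosCoeff_sub {f g : ℝ → ℝ} (hf : Integrable f muOm) (hg : Integrable g muOm) (n : ℤ) :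
    cosCoeff (fun x => f x - g x) n = cosCoeff f n - cosCoeff g n := by
  rw [cosCoeff, cosCoeff, cosCoeff, ← integral_sub (integrable_mul_continuous hf (by fun_prop))
    (integrable_mul_continuous hg (by fun_prop))]
  congr 1
  ext x
  ring

/-- Polarization of the identity for squares. -/
theorem hasSum_cosCoeff_mul {f g : ℝ → ℝ} (hf : MemLp f 2 muOm) (hg : MemLp g 2 muOm) :
    HasSum (fun n => cosCoeff f n * cosCoeff g n) (∫ x in Om, f x * g x) := by
  have h := ((hasSum_cosCoeff_sq (hf.add hg)).sub (hasSum_cosCoeff_sq (hf.sub hg))).div_const 4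
  refine (hasSum_congr_both ?_ ?_).2 h
  · intro n
    have e1 := cosCoeff_add (integrable_of_memLp hf) (integrable_of_memLp hg) n
    have e2 := cosCoeff_sub (integrable_of_memLp hf) (integrable_of_memLp hg) n
    rw [show f + g = fun x => f x + g x from rfl, show f - g = fun x => f x - g x from rfl,
      e1, e2]
    ring
  · rw [← integral_sub (hf.add hg).integrable_sq (hf.sub hg).integrable_sq, ← integral_div]
    congr 1
    ext x
    simp only [Pi.add_apply, Pi.sub_apply]
    ring

/-! ### The real-valued norm and Bessel inequalities. -/

/-- The `L²(0, 1)` norm as a real number. -/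
noncomputable def nrm (f : ℝ → ℝ) : ℝ := √(∫ x in Om, f x ^ 2)

theorem nrm_nonneg (f : ℝ → ℝ) : 0 ≤ nrm f := Real.sqrt_nonneg _

theorem nrm_sq (f : ℝ → ℝ) : nrm f ^ 2 = ∫ x in Om, f x ^ 2 :=
  Real.sq_sqrt (integral_nonneg fun _ => sq_nonneg _)

theorem sum_sinCoeff_sq_le {f : ℝ → ℝ} (hf : MemLp f 2 muOm) (s : Finset ℤ) :
    ∑ n ∈ s, sinCoeff f n ^ 2 ≤ nrm f ^ 2 := by
  rw [nrm_sq]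
  exact sum_le_hasSum s (fun _ _ => sq_nonneg _) (hasSum_sinCoeff_sq hf)

theorem sum_cosCoeff_sq_le {f : ℝ → ℝ} (hf : MemLp f 2 muOm) (s : Finset ℤ) :
    ∑ n ∈ s, cosCoeff f n ^ 2 ≤ nrm f ^ 2 := by
  rw [nrm_sq]
  exact sum_le_hasSum s (fun _ _ => sq_nonneg _) (hasSum_cosCoeff_sq hf)

theorem abs_sum_mul_le {ι : Type*} (s : Finset ι) (a b : ι → ℝ) {A B : ℝ} (hA : 0 ≤ A)
    (hB : 0 ≤ B) (ha : ∑ n ∈ s, a n ^ 2 ≤ A ^ 2) (hb : ∑ n ∈ s, b n ^ 2 ≤ B ^ 2) :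
    |∑ n ∈ s, a n * b n| ≤ A * B := by
  apply abs_le_of_sq_le_sq _ (mul_nonneg hA hB)
  rw [mul_pow]
  exact (Finset.sum_mul_sq_le_sq_mul_sq s a b).trans
    (mul_le_mul ha hb (Finset.sum_nonneg fun _ _ => sq_nonneg _) (sq_nonneg A))

/-! ### Weak derivatives and traces on the unit interval. -/

theorem exists_testFn_integral_eq_one : ∃ η : TestFn, ∫ x, η x = 1 := by
  let B : ContDiffBump (1 / 2 : ℝ) := ⟨1 / 8, 1 / 4, by norm_num, by norm_num⟩
  refine ⟨⟨B.normed volume, B.contDiff_normed, B.hasCompactSupport_normed, ?_⟩, B.integral_normed⟩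
  rw [B.tsupport_normed_eq, Real.closedBall_eq_Icc]
  intro x hx
  have h1 := hx.1
  have h2 := hx.2
  simp only [B] at h1 h2
  exact ⟨by linarith, by linarith⟩

theorem TestFn.contDiff_one (φ : TestFn) : ContDiff ℝ 1 (φ : ℝ → ℝ) :=
  φ.contDiff.of_le (by exact_mod_cast le_top)

theorem TestFn.continuous (φ : TestFn) : Continuous (φ : ℝ → ℝ) := φ.contDiff.continuous

theorem TestFn.eq_zero (φ : TestFn) {x : ℝ} (hx : x ∉ Om) : (φ : ℝ → ℝ) x = 0 :=
  image_eq_zero_of_notMem_tsupport fun h => hx (φ.2.2.2 h)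

theorem TestFn.integrable (φ : TestFn) : Integrable (φ : ℝ → ℝ) :=
  φ.continuous.integrable_of_hasCompactSupport φ.2.2.1

theorem TestFn.setIntegral (φ : TestFn) : ∫ x in Om, φ x = ∫ x, φ x :=
  setIntegral_eq_integral_of_forall_compl_eq_zero fun _ hx => φ.eq_zero hx

/-- A test function minus a multiple of a test function of integral one, so that the mean value
vanishes, is the derivative of a test function. -/
theorem TestFn.exists_deriv_eq (χ η : TestFn) (hη : ∫ x, η x = 1) :
    ∃ ψ : TestFn, ∀ x, deriv (ψ : ℝ → ℝ) x = χ x - (∫ y, χ y) * η x := by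
  have hs : tsupport (fun x => χ x - (∫ y, χ y) * η x) ⊆ Om :=
    (χ - (∫ y, χ y) • η : TestFn).2.2.2
  have hc : HasCompactSupport (fun x => χ x - (∫ y, χ y) * η x) :=
    (χ - (∫ y, χ y) • η : TestFn).2.2.1
  obtain ⟨G, h1, h2, h3, h4⟩ := exists_testFn_primitive
    (χ.contDiff.sub (contDiff_const.mul η.contDiff)) hc ordConnected_Ioo hs (by
      rw [integral_sub χ.integrable (η.integrable.const_mul _), integral_const_mul, hη, mul_one,
        sub_self])
  exact ⟨⟨G, h1, h2, h3⟩, fun x => (h4 x).deriv⟩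

/-- The lemma of du Bois-Reymond. -/
theorem ae_eq_const_of_forall_integral_deriv {D : ℝ → ℝ} (hD : Integrable D muOm)
    (H : ∀ ψ : TestFn, ∫ x in Om, D x * deriv (ψ : ℝ → ℝ) x = 0) :
    ∃ c : ℝ, D =ᵐ[muOm] fun _ => c := by
  obtain ⟨η, hη⟩ := exists_testFn_integral_eq_one
  refine ⟨∫ x in Om, D x * η x, ae_eq_of_forall_integral_mul_eq hD (integrable_const _) ?_⟩
  intro χ h1 h2 h3
  let X : TestFn := ⟨χ, h1, h2, h3⟩
  obtain ⟨ψ, hψ⟩ := X.exists_deriv_eq η hη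
  have h := H ψ
  simp only [hψ] at h
  have i1 : Integrable (fun x => D x * X x) muOm := integrable_mul_continuous hD X.continuous
  have i2 : Integrable (fun x => D x * η x) muOm := integrable_mul_continuous hD η.continuous
  have e1 : ∫ x in Om, D x * (X x - (∫ y, X y) * η x)
      = (∫ x in Om, D x * X x) - (∫ y, X y) * ∫ x in Om, D x * η x := by
    rw [← integral_const_mul, ← integral_sub i1 (i2.const_mul _)]
    congr 1
    ext x
    ring
  have e2 : ∫ x in Om, χ x * (D x - ∫ x in Om, D x * η x)
      = (∫ x in Om, D x * X x) - (∫ y, X y) * ∫ x in Om, D x * η x := by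
    rw [← X.setIntegral, ← integral_mul_const, ← integral_sub i1 (X.integrable.restrict.mul_const _)]
    congr 1
    ext x
    change χ x * _ = D x * χ x - χ x * _
    ring
  rw [e2, ← e1, h]

theorem intervalIntegrable_of_Om {f : ℝ → ℝ} (hf : Integrable f muOm) :
    IntervalIntegrable f volume 0 1 := intervalIntegrable_of_Ioo zero_le_one hf

theorem continuousOn_primitive_Icc {f : ℝ → ℝ} (hf : Integrable f muOm) (c : ℝ) :
    ContinuousOn (primitive f c 0) (Icc 0 1) := by
  simpa using continuousOn_primitive (intervalIntegrable_of_Om hf) c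

theorem integrable_primitive {f : ℝ → ℝ} (hf : Integrable f muOm) (c : ℝ) :
    Integrable (primitive f c 0) muOm :=
  ((continuousOn_primitive_Icc hf c).integrableOn_compact isCompact_Icc).mono_set
    Ioo_subset_Icc_self

/-- Integration by parts on `(0, 1)` for a primitive and a `C¹` function. -/
theorem setIntegral_primitive_mul {f G : ℝ → ℝ} (hf : Integrable f muOm) (c : ℝ)
    (hG : ContDiff ℝ 1 G) :
    (∫ x in Om, f x * G x) + ∫ x in Om, primitive f c 0 x * deriv G x
      = primitive f c 0 1 * G 1 - c * G 0 := by
  rw [← integral_primitive_mul_contDiff (intervalIntegrable_of_Om hf) c hG,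
    ← integral_Ioo_eq_interval zero_le_one, integral_add]
  · exact integrable_mul_continuous hf hG.continuous
  · exact integrable_mul_continuous (integrable_primitive hf c) (hG.continuous_deriv le_rfl)

/-- Subtracting the primitive of `f'` leaves a function with zero weak derivative, to which the
lemma of du Bois-Reymond applies. -/
theorem IsWeakDeriv.exists_ae_eq_primitive {f f' : ℝ → ℝ} (h : IsWeakDeriv f f') :
    ∃ c : ℝ, f =ᵐ[muOm] primitive f' c 0 := by
  have hV := integrable_primitive h.integrable_deriv 0
  obtain ⟨c, hc⟩ := ae_eq_const_of_forall_integral_deriv (D := fun x => f x - primitive f' 0 0 x)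
    (h.integrable.sub hV) (fun ψ => by
      have e1 := h.integral_eq ψ
      have e2 := setIntegral_primitive_mul h.integrable_deriv 0 ψ.contDiff_one
      rw [ψ.eq_zero (x := 1) (by simp)] at e2
      have hd : Continuous (deriv (ψ : ℝ → ℝ)) := ψ.contDiff_one.continuous_deriv le_rfl
      simp only [sub_mul]
      rw [integral_sub (integrable_mul_continuous h.integrable hd)
        (integrable_mul_continuous hV hd)]
      linarith)
  refine ⟨c, ?_⟩
  filter_upwards [hc] with x hx
  rw [primitive] at hx ⊢
  linarith

/-- A weakly differentiable function with vanishing trace is the primitive of its derivative. -/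
theorem IsWeakDeriv.ae_eq_primitive {f f' : ℝ → ℝ} (h : IsWeakDeriv f f')
    (ht : HasTrace f 0 0) : f =ᵐ[muOm] primitive f' 0 0 ∧ primitive f' 0 0 1 = 0 := by
  obtain ⟨c, hc⟩ := h.exists_ae_eq_primitive
  obtain ⟨w, hw, hfw, h0, h1⟩ := ht
  have hae : primitive f' c 0 =ᵐ[volume.restrict (Icc 0 1)] w := by
    rw [Measure.restrict_congr_set Ioo_ae_eq_Icc.symm]
    exact hc.symm.trans hfw
  -- Two continuous representatives agree up to the end points, so the trace can be read off from
  -- the primitive.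
  have heq := Measure.eqOn_Icc_of_ae_eq volume (zero_ne_one' ℝ) hae
    (continuousOn_primitive_Icc h.integrable_deriv c) hw
  have hc0 : c = 0 := by
    rw [← h0, ← heq (left_mem_Icc.2 zero_le_one), primitive_self]
  subst hc0
  exact ⟨hc, by rw [heq (right_mem_Icc.2 zero_le_one), h1]⟩

/-- Integration by parts. The cosine does not vanish at the end points, so the boundary terms
disappear only because of the zero trace of `f`. -/
theorem IsWeakDeriv.cosCoeff_eq {f f' : ℝ → ℝ} (h : IsWeakDeriv f f') (ht : HasTrace f 0 0)
    (n : ℤ) : cosCoeff f' n = n * Real.pi * sinCoeff f n := by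
  obtain ⟨h1, h2⟩ := h.ae_eq_primitive ht
  have e := setIntegral_primitive_mul (G := fun x => Real.cos (n * Real.pi * x))
    h.integrable_deriv 0 (by fun_prop)
  rw [h2, zero_mul, zero_mul, sub_self] at e
  have e2 : ∫ x in Om, primitive f' 0 0 x * deriv (fun x => Real.cos (n * Real.pi * x)) x
      = -(n * Real.pi * sinCoeff f n) := by
    rw [sinCoeff, ← integral_const_mul, ← integral_neg]
    refine integral_congr_ae ?_
    filter_upwards [h1] with x hx
    have : HasDerivAt (fun x : ℝ => Real.cos (n * Real.pi * x))
        (-Real.sin (n * Real.pi * x) * (n * Real.pi * 1)) x :=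
      ((hasDerivAt_id x).const_mul (n * Real.pi : ℝ)).cos
    rw [this.deriv, hx]
    ring
  rw [e2] at e
  rw [cosCoeff]
  linarith

theorem IsWeakDeriv.integral_mul_self {f f' : ℝ → ℝ} (h : IsWeakDeriv f f')
    (ht : HasTrace f 0 0) : ∫ x in Om, f x * f' x = 0 := by
  obtain ⟨h1, h2⟩ := h.ae_eq_primitive ht
  have e := sq_primitive (intervalIntegrable_of_Om h.integrable_deriv) 0
  rw [h2, ← integral_Ioo_eq_interval zero_le_one] at e
  have : ∫ x in Om, f x * f' x = ∫ x in Om, primitive f' 0 0 x * f' x := by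
    refine integral_congr_ae ?_
    filter_upwards [h1] with x hx
    rw [hx]
  rw [this]
  linarith

/-! ### Hilbert space arguments: the structure of `H⁻¹` and approximation of sines by test
functions. -/

theorem inner_toLp {f g : ℝ → ℝ} (hf : MemLp f 2 muOm) (hg : MemLp g 2 muOm) :
    inner ℝ (hf.toLp f) (hg.toLp g) = ∫ x in Om, f x * g x := by
  rw [L2.inner_def]
  refine integral_congr_ae ?_
  filter_upwards [hf.coeFn_toLp, hg.coeFn_toLp] with x h1 h2
  rw [h1, h2]
  simp [mul_comm]

theorem norm_toLp_eq_nrm {f : ℝ → ℝ} (hf : MemLp f 2 muOm) : ‖hf.toLp f‖ = nrm f := by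
  rw [nrm, norm_eq_sqrt_real_inner, inner_toLp]
  simp_rw [sq]

theorem abs_integral_mul_le {f g : ℝ → ℝ} (hf : MemLp f 2 muOm) (hg : MemLp g 2 muOm) :
    |∫ x in Om, f x * g x| ≤ nrm f * nrm g := by
  rw [← inner_toLp hf hg, ← norm_toLp_eq_nrm hf, ← norm_toLp_eq_nrm hg]
  exact abs_real_inner_le_norm _ _

theorem eLpNorm_eq_nrm {f : ℝ → ℝ} (hf : MemLp f 2 muOm) :
    eLpNorm f 2 muOm = ENNReal.ofReal (nrm f) := by
  rw [← norm_toLp_eq_nrm hf, Lp.norm_toLp, ENNReal.ofReal_toReal hf.eLpNorm_ne_top]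

theorem integral_abs_le_nrm {f : ℝ → ℝ} (hf : MemLp f 2 muOm) : ∫ x in Om, |f x| ≤ nrm f := by
  have h := abs_integral_mul_le hf.abs (memLp_const (1 : ℝ))
  have h1 : nrm (fun _ => (1 : ℝ)) = 1 := by simp [nrm]
  have h2 : nrm |f| = nrm f := by simp [nrm]
  rw [h1, h2] at h
  simpa using (le_abs_self _).trans h

theorem TestFn.norm_eq (φ : TestFn) : ‖φ‖ = nrm (deriv (φ : ℝ → ℝ)) :=
  norm_toLp_eq_nrm φ.memLp_deriv

theorem TestFn.memLp (φ : TestFn) (p : ℝ≥0∞) : MemLp (φ : ℝ → ℝ) p muOm :=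
  memLp_of_continuous φ.continuous p

/-- The embedding of `H¹₀(0, 1)` into bounded functions. -/
theorem TestFn.abs_le_norm (φ : TestFn) (x : ℝ) : |φ x| ≤ ‖φ‖ := by
  by_cases hx : x ∈ Om
  · have hd : Continuous (deriv (φ : ℝ → ℝ)) := φ.contDiff_one.continuous_deriv le_rfl
    have h := intervalIntegral.integral_deriv_eq_sub (f := (φ : ℝ → ℝ)) (a := 0) (b := x)
      (fun y _ => φ.contDiff_one.differentiable one_ne_zero y) (hd.intervalIntegrable _ _)
    rw [φ.eq_zero (x := 0) (by simp), sub_zero] at h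
    rw [← h, φ.norm_eq]
    refine le_trans ?_ (integral_abs_le_nrm φ.memLp_deriv)
    refine (intervalIntegral.abs_integral_le_integral_abs hx.1.le).trans ?_
    rw [← integral_Ioo_eq_interval hx.1.le]
    exact setIntegral_mono_set (integrable_of_memLp φ.memLp_deriv).abs
      (Eventually.of_forall fun _ => abs_nonneg _)
      (Ioo_subset_Ioo_right hx.2.le).eventuallyLE
  · rw [φ.eq_zero hx, abs_zero]
    exact norm_nonneg _

/-- The Poincaré inequality. -/
theorem TestFn.nrm_le_norm (φ : TestFn) : nrm (φ : ℝ → ℝ) ≤ ‖φ‖ := by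
  rw [nrm]
  apply Real.sqrt_le_iff.2 ⟨norm_nonneg _, ?_⟩
  calc ∫ x in Om, φ x ^ 2 ≤ ∫ _ in Om, ‖φ‖ ^ 2 := by
        refine integral_mono (φ.memLp 2).integrable_sq (integrable_const _) fun x => ?_
        exact sq_le_sq.2 (by rw [abs_of_nonneg (norm_nonneg φ)]; exact φ.abs_le_norm x)
    _ = ‖φ‖ ^ 2 := by simp

/-- A bounded functional cannot separate elements at distance zero, and the distance is measured by
the gradient alone. This makes `r` well defined on the range of `TestFn.grad`. -/
theorem HNegOne.eq_of_grad_eq (r : HNegOne) {φ ψ : TestFn} (h : φ.grad = ψ.grad) :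
    r φ = r ψ := by
  have h0 : ‖φ - ψ‖ = 0 := by
    change ‖TestFn.grad (φ - ψ)‖ = 0
    rw [map_sub, h, sub_self, norm_zero]
  have h1 := r.le_opNorm (φ - ψ)
  rw [h0, mul_zero, map_sub] at h1
  exact sub_eq_zero.1 (norm_le_zero_iff.1 h1)

/-- Elements of `H⁻¹(0, 1)` are derivatives of functions in `L²(0, 1)`. -/
theorem HNegOne.exists_representation (r : HNegOne) :
    ∃ G : ℝ → ℝ, MemLp G 2 muOm ∧ nrm G ≤ ‖r‖ ∧
      ∀ φ : TestFn, r φ = ∫ x in Om, G x * deriv (φ : ℝ → ℝ) x := by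
  -- Through the gradient, `r` becomes a functional on a subspace of `L²`. Hahn-Banach extends it to
  -- all of `L²` without increasing the norm, and the Riesz theorem gives `G`.
  let p : Submodule ℝ (Lp ℝ 2 muOm) := LinearMap.range TestFn.grad
  have hp : ∀ y : p, ∃ φ : TestFn, φ.grad = (y : Lp ℝ 2 muOm) := fun y => y.2
  choose c hc using hp
  let L : p →ₗ[ℝ] ℝ :=
    { toFun := fun y => r (c y)
      map_add' := fun y z => by
        rw [← map_add]
        exact r.eq_of_grad_eq (by rw [map_add, hc, hc, hc]; rfl)
      map_smul' := fun a y => by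
        rw [RingHom.id_apply, ← map_smul]
        exact r.eq_of_grad_eq (by rw [map_smul, hc, hc]; rfl) }
  let L' : p →L[ℝ] ℝ := L.mkContinuous ‖r‖ (fun y => by
    refine (r.le_opNorm (c y)).trans_eq ?_
    congr 1
    change ‖TestFn.grad (c y)‖ = _
    rw [hc]
    rfl)
  obtain ⟨E, hE, hEn⟩ := exists_extension_norm_eq p L'
  let G := (InnerProductSpace.toDual ℝ (Lp ℝ 2 muOm)).symm E
  have hG : MemLp (G : ℝ → ℝ) 2 muOm := Lp.memLp G
  have hGG : hG.toLp _ = G := Lp.toLp_coeFn G hG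
  refine ⟨G, hG, ?_, fun φ => ?_⟩
  · rw [← norm_toLp_eq_nrm hG, hGG, LinearIsometryEquiv.norm_map, hEn]
    exact L.mkContinuous_norm_le (norm_nonneg _) _
  · rw [← inner_toLp hG φ.memLp_deriv, hGG, InnerProductSpace.toDual_symm_apply]
    have := hE ⟨φ.grad, φ, rfl⟩
    refine Eq.trans ?_ this.symm
    exact r.eq_of_grad_eq (hc ⟨φ.grad, φ, rfl⟩).symm

/-- Derivatives of test functions are dense in the functions with mean value zero. -/
theorem exists_seq_grad_tendsto {g : ℝ → ℝ} (hg : MemLp g 2 muOm) (h0 : ∫ x in Om, g x = 0) :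
    ∃ ψ : ℕ → TestFn, Tendsto (fun j => (ψ j).grad) atTop (𝓝 (hg.toLp g)) := by
  let p : Submodule ℝ (Lp ℝ 2 muOm) := LinearMap.range TestFn.grad
  -- By du Bois-Reymond the orthogonal complement of the derivatives consists of constants, and `g`
  -- is orthogonal to these.
  have hmem : hg.toLp g ∈ p.topologicalClosure := by
    rw [← Submodule.orthogonal_orthogonal_eq_closure, Submodule.mem_orthogonal]
    intro h hh
    have hhL : MemLp (h : ℝ → ℝ) 2 muOm := Lp.memLp h
    have hhh : hhL.toLp _ = h := Lp.toLp_coeFn h hhL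
    obtain ⟨c, hc⟩ := ae_eq_const_of_forall_integral_deriv (integrable_of_memLp hhL) (fun ψ => by
      rw [← inner_toLp hhL ψ.memLp_deriv, hhh, real_inner_comm]
      exact (Submodule.mem_orthogonal _ _).1 hh _ ⟨ψ, rfl⟩)
    rw [← hhh, inner_toLp hhL hg]
    have : ∫ x in Om, h x * g x = ∫ x in Om, c * g x := by
      refine integral_congr_ae ?_
      filter_upwards [hc] with x hx
      rw [hx]
    rw [this, integral_const_mul, h0, mul_zero]
  obtain ⟨x, hx, hxt⟩ := mem_closure_iff_seq_limit.1 hmem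
  choose ψ hψ using hx
  exact ⟨ψ, by simpa only [hψ] using hxt⟩

/-- `sin (n π x)` is the limit of test functions in `H¹₀(0, 1)`. -/
theorem exists_seq_tendsto_sin (n : ℤ) : ∃ ψ : ℕ → TestFn,
    (∃ C, ∀ j, ‖ψ j‖ ≤ C) ∧
    (∀ f : ℝ → ℝ, MemLp f 2 muOm → Tendsto (fun j => ∫ x in Om, f x * deriv (ψ j : ℝ → ℝ) x)
      atTop (𝓝 (n * Real.pi * cosCoeff f n))) ∧
    (∀ f : ℝ → ℝ, MemLp f 2 muOm → Tendsto (fun j => ∫ x in Om, f x * ψ j x)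
      atTop (𝓝 (sinCoeff f n))) := by
  have hder : ∀ x : ℝ, HasDerivAt (fun x : ℝ => Real.sin (n * Real.pi * x))
      (n * Real.pi * Real.cos (n * Real.pi * x)) x := fun x => by
    have := ((hasDerivAt_id x).const_mul (n * Real.pi : ℝ)).sin
    convert! this using 1
    simp only [id_eq]
    ring
  have hg : MemLp (fun x : ℝ => n * Real.pi * Real.cos (n * Real.pi * x)) 2 muOm :=
    memLp_of_continuous (by fun_prop) 2
  -- The mean value vanishes because the sine is zero at both end points.
  have h0 : ∫ x in Om, n * Real.pi * Real.cos (n * Real.pi * x) = 0 := by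
    rw [integral_Ioo_eq_interval zero_le_one,
      intervalIntegral.integral_eq_sub_of_hasDerivAt (fun x _ => hder x)
        ((by fun_prop : Continuous _).intervalIntegrable _ _)]
    simp
  obtain ⟨ψ, hψ⟩ := exists_seq_grad_tendsto hg h0
  have key : ∀ f : ℝ → ℝ, MemLp f 2 muOm →
      Tendsto (fun j => ∫ x in Om, f x * deriv (ψ j : ℝ → ℝ) x)
        atTop (𝓝 (n * Real.pi * cosCoeff f n)) := by
    intro f hf
    have h := (tendsto_const_nhds (x := hf.toLp f)).inner (𝕜 := ℝ) hψ
    rw [inner_toLp hf hg] at h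
    have e : n * Real.pi * cosCoeff f n
        = ∫ x in Om, f x * (n * Real.pi * Real.cos (n * Real.pi * x)) := by
      rw [cosCoeff, ← integral_const_mul]
      congr 1
      ext x
      ring
    rw [e]
    refine h.congr fun j => ?_
    exact inner_toLp hf (ψ j).memLp_deriv
  refine ⟨ψ, ?_, key, fun f hf => ?_⟩
  · obtain ⟨C, hC⟩ := hψ.norm.bddAbove_range
    exact ⟨C, fun j => hC ⟨j, rfl⟩⟩
  · have hfi := integrable_of_memLp hf
    have hP : MemLp (primitive f 0 0) 2 muOm := by
      obtain ⟨C, hC⟩ := isCompact_Icc.exists_bound_of_continuousOn (continuousOn_primitive_Icc hfi 0)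
      refine MemLp.of_bound (integrable_primitive hfi 0).aestronglyMeasurable C ?_
      filter_upwards [ae_restrict_mem measurableSet_Ioo] with x hx
      exact hC x (Ioo_subset_Icc_self hx)
    have h := (key _ hP).neg
    have e1 : -(n * Real.pi * cosCoeff (primitive f 0 0) n) = sinCoeff f n := by
      have := setIntegral_primitive_mul (G := fun x => Real.sin (n * Real.pi * x)) hfi 0
        (by fun_prop)
      simp only [(hder _).deriv, mul_one, Real.sin_int_mul_pi, mul_zero, Real.sin_zero,
        sub_zero] at this
      have e2 : n * Real.pi * cosCoeff (primitive f 0 0) n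
          = ∫ x in Om, primitive f 0 0 x * (n * Real.pi * Real.cos (n * Real.pi * x)) := by
        rw [cosCoeff, ← integral_const_mul]
        congr 1
        ext x
        ring
      rw [e2, sinCoeff]
      linarith
    rw [e1] at h
    refine h.congr fun j => ?_
    have := setIntegral_primitive_mul hfi 0 (ψ j).contDiff_one
    rw [(ψ j).eq_zero (x := 1) (by simp)] at this
    linarith

/-! ### Slices of functions on the cylinder: measurability, integrability and Fubini. -/

theorem muCyl_eq_prod (T : ℝ) : muCyl T = (muTime T).prod muOm := by
  rw [muCyl, muTime, muOm, Measure.prod_restrict, Measure.volume_eq_prod]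

theorem ae_aestronglyMeasurable_slice {T : ℝ} {f : ℝ → ℝ → ℝ}
    (hf : AEStronglyMeasurable (Function.uncurry f) (muCyl T)) :
    ∀ᵐ t ∂(muTime T), AEStronglyMeasurable (f t) muOm := by
  rw [muCyl_eq_prod] at hf
  exact hf.prodMk_left

theorem eLpNorm_two_sq {α : Type*} {m : MeasurableSpace α} {μ : Measure α} {f : α → ℝ} :
    eLpNorm f 2 μ ^ 2 = ∫⁻ x, ‖f x‖ₑ ^ 2 ∂μ := by
  rw [eLpNorm_eq_lintegral_rpow_enorm_toReal two_ne_zero ENNReal.ofNat_ne_top,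
    ← ENNReal.rpow_natCast, ← ENNReal.rpow_mul]
  simp

theorem aemeasurable_eLpNorm_slice {T : ℝ} {f : ℝ → ℝ → ℝ}
    (hf : AEStronglyMeasurable (Function.uncurry f) (muCyl T)) :
    AEMeasurable (fun t => eLpNorm (f t) 2 muOm) (muTime T) := by
  rw [muCyl_eq_prod] at hf
  have h : AEMeasurable (fun t => ∫⁻ x in Om, ‖f t x‖ₑ ^ 2) (muTime T) :=
    AEMeasurable.lintegral_prod_right' (f := fun z : ℝ × ℝ => ‖f z.1 z.2‖ₑ ^ 2)
      (hf.enorm.pow_const 2)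
  have h2 := h.pow_const (1 / 2 : ℝ)
  refine h2.congr (Eventually.of_forall fun t => ?_)
  simp only [← eLpNorm_two_sq]
  rw [← ENNReal.rpow_natCast, ← ENNReal.rpow_mul]
  simp

theorem ae_eq_toReal_eLpNorm {T : ℝ} {f : ℝ → ℝ → ℝ} (hf : ∀ᵐ t ∂(muTime T), MemLp (f t) 2 muOm) :
    (fun t => nrm (f t)) =ᵐ[muTime T] fun t => (eLpNorm (f t) 2 muOm).toReal := by
  filter_upwards [hf] with t ht
  rw [eLpNorm_eq_nrm ht, ENNReal.toReal_ofReal (nrm_nonneg _)]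

theorem aestronglyMeasurable_nrm {T : ℝ} {f : ℝ → ℝ → ℝ}
    (hf : AEStronglyMeasurable (Function.uncurry f) (muCyl T))
    (h : ∀ᵐ t ∂(muTime T), MemLp (f t) 2 muOm) :
    AEStronglyMeasurable (fun t => nrm (f t)) (muTime T) :=
  (aemeasurable_eLpNorm_slice hf).ennreal_toReal.aestronglyMeasurable.congr
    (ae_eq_toReal_eLpNorm h).symm

theorem ae_memLp_slice {T : ℝ} {f : ℝ → ℝ → ℝ} (hf : MemLp (Function.uncurry f) 2 (muCyl T)) :
    ∀ᵐ t ∂(muTime T), MemLp (f t) 2 muOm := by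
  have h := hf.integrable_sq
  rw [muCyl_eq_prod] at h
  filter_upwards [ae_aestronglyMeasurable_slice hf.1, h.prod_right_ae] with t h1 h2
  exact (memLp_two_iff_integrable_sq h1).2 h2

theorem integrable_nrm_sq {T : ℝ} {f : ℝ → ℝ → ℝ} (hf : MemLp (Function.uncurry f) 2 (muCyl T)) :
    Integrable (fun t => nrm (f t) ^ 2) (muTime T) := by
  have h := hf.integrable_sq
  rw [muCyl_eq_prod] at h
  simp_rw [nrm_sq]
  exact h.integral_prod_left

theorem integral_nrm_sq {T : ℝ} {f : ℝ → ℝ → ℝ} (hf : MemLp (Function.uncurry f) 2 (muCyl T)) :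
    ∫ t in Ioo 0 T, nrm (f t) ^ 2 = ∫ z, f z.1 z.2 ^ 2 ∂(muCyl T) := by
  have h := hf.integrable_sq
  rw [muCyl_eq_prod] at h ⊢
  simp_rw [nrm_sq]
  exact (integral_prod _ h).symm

theorem memLp_nrm {T : ℝ} {f : ℝ → ℝ → ℝ} (hf : MemLp (Function.uncurry f) 2 (muCyl T)) :
    MemLp (fun t => nrm (f t)) 2 (muTime T) :=
  (memLp_two_iff_integrable_sq (aestronglyMeasurable_nrm hf.1 (ae_memLp_slice hf))).2
    (integrable_nrm_sq hf)

theorem MemL1L2.ae_memLp {T : ℝ} {r : ℝ → ℝ → ℝ} (hr : MemL1L2 T r) :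
    ∀ᵐ t ∂(muTime T), MemLp (r t) 2 muOm := by
  have h := hr.norm_lt_top
  rw [normLpL2, eLpNorm_one_eq_lintegral_enorm] at h
  simp only [enorm_eq_self] at h
  filter_upwards [ae_aestronglyMeasurable_slice hr.1,
    ae_lt_top' (aemeasurable_eLpNorm_slice hr.1) h.ne] with t h1 h2
  exact ⟨h1, h2⟩

theorem MemL1L2.integrable_nrm {T : ℝ} {r : ℝ → ℝ → ℝ} (hr : MemL1L2 T r) :
    Integrable (fun t => nrm (r t)) (muTime T) := by
  have h := hr.norm_lt_top
  rw [normLpL2, eLpNorm_one_eq_lintegral_enorm] at h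
  simp only [enorm_eq_self] at h
  exact (integrable_toReal_of_lintegral_ne_top (aemeasurable_eLpNorm_slice hr.1) h.ne).congr
    (ae_eq_toReal_eLpNorm hr.ae_memLp).symm

/-- On an interval of length one the `L²` norm dominates the `L¹` norm, so Tonelli's criterion
applies. -/
theorem MemL1L2.integrable {T : ℝ} {r : ℝ → ℝ → ℝ} (hr : MemL1L2 T r) :
    Integrable (Function.uncurry r) (muCyl T) := by
  have hm := hr.1
  rw [muCyl_eq_prod] at hm ⊢
  rw [integrable_prod_iff hm]
  refine ⟨hr.ae_memLp.mono fun t ht => integrable_of_memLp ht, ?_⟩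
  refine hr.integrable_nrm.mono' (hm.norm.integral_prod_right') ?_
  filter_upwards [hr.ae_memLp] with t ht
  rw [Real.norm_of_nonneg (integral_nonneg fun _ => norm_nonneg _)]
  exact integral_abs_le_nrm ht

theorem nrm_le_of_ae_bound {f : ℝ → ℝ} (hf : MemLp f 2 muOm) {C : ℝ} (hC : 0 ≤ C)
    (h : ∀ᵐ x ∂muOm, |f x| ≤ C) : nrm f ≤ C := by
  apply Real.sqrt_le_iff.2 ⟨hC, ?_⟩
  calc ∫ x in Om, f x ^ 2 ≤ ∫ _ in Om, C ^ 2 := by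
        refine integral_mono_ae hf.integrable_sq (integrable_const _) ?_
        filter_upwards [h] with x hx
        exact sq_le_sq.2 (by rwa [abs_of_nonneg hC])
    _ = C ^ 2 := by simp

instance (T : ℝ) : IsFiniteMeasure (muCyl T) := by
  rw [muCyl_eq_prod]
  infer_instance

/-- Since the interval has length one, the essential bound on the cylinder serves on almost every
slice. It guarantees that the supremum absorbed at the end is finite. -/
theorem exists_nrm_le {T : ℝ} {f : ℝ → ℝ → ℝ} (hf : MemLp (Function.uncurry f) ∞ (muCyl T)) :
    ∃ C, 0 ≤ C ∧ ∀ᵐ t ∂(muTime T), nrm (f t) ≤ C := by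
  have h2 : MemLp (Function.uncurry f) 2 (muCyl T) := hf.mono_exponent le_top
  refine ⟨(eLpNormEssSup (Function.uncurry f) (muCyl T)).toReal, ENNReal.toReal_nonneg, ?_⟩
  have h := ae_le_eLpNormEssSup (f := Function.uncurry f) (μ := muCyl T)
  have hfin : eLpNormEssSup (Function.uncurry f) (muCyl T) ≠ ∞ := by
    rw [← eLpNorm_exponent_top]
    exact hf.eLpNorm_ne_top
  have h' : ∀ᵐ z ∂((muTime T).prod muOm),
      |f z.1 z.2| ≤ (eLpNormEssSup (Function.uncurry f) (muCyl T)).toReal := by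
    rw [← muCyl_eq_prod]
    filter_upwards [h] with z hz
    have := ENNReal.toReal_mono hfin hz
    simpa [Function.uncurry] using this
  filter_upwards [Measure.ae_ae_of_ae_prod h', ae_memLp_slice h2] with t h3 h4
  exact nrm_le_of_ae_bound h4 ENNReal.toReal_nonneg h3

/-- Fubini's theorem for products with separated test functions. -/
theorem integral_cyl_mul {T : ℝ} {f : ℝ → ℝ → ℝ} (hf : Integrable (Function.uncurry f) (muCyl T))
    {a g : ℝ → ℝ} (ha : Continuous a) (hac : HasCompactSupport a) (hg : Continuous g)
    (hgc : HasCompactSupport g) :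
    Integrable (fun z : ℝ × ℝ => a z.1 * g z.2 * f z.1 z.2) (muCyl T) ∧
    Integrable (fun t => a t * ∫ x in Om, f t x * g x) (muTime T) ∧
    ∫ z, a z.1 * g z.2 * f z.1 z.2 ∂(muCyl T)
      = ∫ t in Ioo 0 T, a t * ∫ x in Om, f t x * g x := by
  obtain ⟨A, hA⟩ := hac.exists_bound_of_continuous ha
  obtain ⟨B, hB⟩ := hgc.exists_bound_of_continuous hg
  have h1 : Integrable (fun z : ℝ × ℝ => a z.1 * g z.2 * f z.1 z.2) (muCyl T) := by
    refine hf.bdd_mul (c := A * B) (by fun_prop) (Eventually.of_forall fun z => ?_)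
    rw [norm_mul]
    exact mul_le_mul (hA _) (hB _) (norm_nonneg _) ((norm_nonneg _).trans (hA z.1))
  have e : ∀ t, ∫ x in Om, a t * g x * f t x = a t * ∫ x in Om, f t x * g x := by
    intro t
    rw [← integral_const_mul]
    congr 1
    ext x
    ring
  have h1' := h1
  rw [muCyl_eq_prod] at h1'
  refine ⟨h1, ?_, ?_⟩
  · simpa only [e] using h1'.integral_prod_left
  · rw [muCyl_eq_prod, integral_prod _ h1']
    simp only [e]

/-! ### The homogeneous Dirichlet problem for the difference. -/

/-- The test function `θ(t) ψ(x)`. -/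
noncomputable def CylTest.ofProd {T : ℝ} {θ : ℝ → ℝ} (h1 : ContDiff ℝ (⊤ : ℕ∞) θ)
    (h2 : HasCompactSupport θ) (h3 : tsupport θ ⊆ Iio T) (ψ : TestFn) : CylTest T :=
  have hsub : tsupport (Function.uncurry fun t x => θ t * ψ x)
      ⊆ tsupport θ ×ˢ tsupport (ψ : ℝ → ℝ) := by
    refine closure_minimal ?_ ((isClosed_tsupport _).prod (isClosed_tsupport _))
    intro z hz
    exact ⟨subset_tsupport _ (left_ne_zero_of_mul hz), subset_tsupport _ (right_ne_zero_of_mul hz)⟩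
  { toFun := fun t x => θ t * ψ x
    smooth := (h1.comp contDiff_fst).mul (ψ.contDiff.comp contDiff_snd)
    compact := (h2.isCompact.prod ψ.2.2.1.isCompact).of_isClosed_subset (isClosed_tsupport _) hsub
    supp := hsub.trans (prod_mono h3 ψ.2.2.2) }

theorem eLpNorm_norm_eq (T : ℝ) (r : ℝ → HNegOne) :
    eLpNorm (fun t => ‖r t‖) 2 (muTime T) = eLpNorm r 2 (muTime T) :=
  eLpNorm_congr_enorm_ae (Eventually.of_forall fun t => by
    rw [← ofReal_norm, norm_norm, ofReal_norm])

theorem memLp_norm {T : ℝ} {r : ℝ → HNegOne} (hr : MemLp r 2 (muTime T)) :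
    MemLp (fun t => ‖r t‖) 2 (muTime T) := by
  refine ⟨continuous_norm.comp_aestronglyMeasurable hr.1, ?_⟩
  rw [eLpNorm_norm_eq]
  exact hr.2

theorem integrable_apply {T : ℝ} {r : ℝ → HNegOne} (hr : MemLp r 2 (muTime T)) (ψ : TestFn) :
    Integrable (fun t => r t ψ) (muTime T) := by
  let L : HNegOne →L[ℝ] ℝ := ContinuousLinearMap.apply ℝ ℝ ψ
  exact (((memLp_norm hr).integrable one_le_two).mul_const ‖ψ‖).mono'
    (L.continuous.comp_aestronglyMeasurable hr.1)
    (Eventually.of_forall fun t => (r t).le_opNorm ψ)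

theorem _root_.MeasureTheory.Integrable.fun_sub {α : Type*} {m : MeasurableSpace α}
    {μ : Measure α} {f g : α → ℝ} (hf : Integrable f μ) (hg : Integrable g μ) :
    Integrable (fun x => f x - g x) μ := hf.sub hg

/-- The right-hand side of the equation `∂_t w = -b ∂_x w + ε ∂_xx w - r₁ - ε r₂`, tested
with `ψ`. -/
noncomputable def flux (ε b : ℝ) (w wx r₁ : ℝ → ℝ → ℝ) (r₂ : ℝ → HNegOne) (ψ : TestFn)
    (t : ℝ) : ℝ :=
  b * (∫ x in Om, w t x * deriv (ψ : ℝ → ℝ) x) - ε * (∫ x in Om, wx t x * deriv (ψ : ℝ → ℝ) x)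
    - (∫ x in Om, r₁ t x * ψ x) - ε * r₂ t ψ

/-- Bounded weak solutions `w ∈ L²(0, T; H¹₀(0, 1))` of
`∂_t w + b ∂_x w = ε ∂_xx w - r₁ - ε r₂` with initial values `w₀`. -/
structure IsHomogeneousSolution (ε b T : ℝ) (w₀ : ℝ → ℝ) (w wx r₁ : ℝ → ℝ → ℝ)
    (r₂ : ℝ → HNegOne) : Prop where
  init : MemLp w₀ 2 muOm
  bounded : MemLp (Function.uncurry w) ∞ (muCyl T)
  memLp_dx : MemLp (Function.uncurry wx) 2 (muCyl T)
  weakDeriv : IsWeakDerivX T w wx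
  trace : ∀ᵐ t ∂(muTime T), HasTrace (w t) 0 0
  memL1L2 : MemL1L2 T r₁
  memLp_neg : MemLp r₂ 2 (muTime T)
  equation : ∀ θ : ℝ → ℝ, ContDiff ℝ (⊤ : ℕ∞) θ → HasCompactSupport θ → tsupport θ ⊆ Iio T →
    ∀ ψ : TestFn, (∫ t in Ioo 0 T, (deriv θ t * (∫ x in Om, w t x * ψ x)
      + θ t * flux ε b w wx r₁ r₂ ψ t)) + θ 0 * ∫ x in Om, w₀ x * ψ x = 0

theorem IsWeakDeriv.sub {f f' g g' : ℝ → ℝ} (hf : IsWeakDeriv f f') (hg : IsWeakDeriv g g') :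
    IsWeakDeriv (fun x => f x - g x) (fun x => f' x - g' x) where
  integrable := hf.integrable.sub hg.integrable
  integrable_deriv := hf.integrable_deriv.sub hg.integrable_deriv
  integral_eq ψ := by
    have hd : Continuous (deriv (ψ : ℝ → ℝ)) := ψ.contDiff_one.continuous_deriv le_rfl
    simp only [sub_mul]
    rw [integral_sub (integrable_mul_continuous hf.integrable hd)
        (integrable_mul_continuous hg.integrable hd),
      integral_sub (integrable_mul_continuous hf.integrable_deriv ψ.continuous)
        (integrable_mul_continuous hg.integrable_deriv ψ.continuous),
      hf.integral_eq, hg.integral_eq]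
    ring

theorem HasTrace.sub {f g : ℝ → ℝ} {a₀ a₁ c₀ c₁ : ℝ} (hf : HasTrace f a₀ a₁)
    (hg : HasTrace g c₀ c₁) : HasTrace (fun x => f x - g x) (a₀ - c₀) (a₁ - c₁) := by
  obtain ⟨F, h1, h2, h3, h4⟩ := hf
  obtain ⟨G, k1, k2, k3, k4⟩ := hg
  exact ⟨fun x => F x - G x, h1.sub k1, h2.sub k2, by simp only [h3, k3], by simp only [h4, k4]⟩

theorem memLp_top_of_isLip {T : ℝ} {v : ℝ → ℝ → ℝ}
    (hv : IsLip (Function.uncurry v) (Icc 0 T ×ˢ Icc 0 1)) :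
    MemLp (Function.uncurry v) ∞ (muCyl T) := by
  obtain ⟨K, hK⟩ := hv
  have hsub : Ioo 0 T ×ˢ Om ⊆ Icc 0 T ×ˢ Icc 0 1 :=
    prod_mono Ioo_subset_Icc_self Ioo_subset_Icc_self
  have hm : MeasurableSet (Ioo 0 T ×ˢ Om) := measurableSet_Ioo.prod measurableSet_Ioo
  obtain ⟨C, hC⟩ := (isCompact_Icc.prod isCompact_Icc).exists_bound_of_continuousOn hK.continuousOn
  refine MemLp.of_bound ((hK.continuousOn.mono hsub).aestronglyMeasurable hm) C ?_
  filter_upwards [ae_restrict_mem hm] with z hz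
  exact hC z (hsub hz)

theorem memLp_of_isLip {v : ℝ → ℝ} (hv : IsLip v (Icc 0 1)) : MemLp v 2 muOm := by
  obtain ⟨K, hK⟩ := hv
  obtain ⟨C, hC⟩ := isCompact_Icc.exists_bound_of_continuousOn hK.continuousOn
  refine MemLp.of_bound ((hK.continuousOn.mono Ioo_subset_Icc_self).aestronglyMeasurable
    measurableSet_Ioo) C ?_
  filter_upwards [ae_restrict_mem measurableSet_Ioo] with x hx
  exact hC x (Ioo_subset_Icc_self hx)

/-- By linearity the two weak formulations, tested with products `θ(t) ψ(x)`, can be subtracted. The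
boundary data cancel and the residual changes sign. -/
theorem isHomogeneousSolution_sub {ε b T : ℝ} {g₀ g₁ u₀ v₀ : ℝ → ℝ} {u ux v vx r₁ : ℝ → ℝ → ℝ}
    {r₂ : ℝ → HNegOne} (hu₀ : MemH1 u₀) (hu : MemL2H1 T u ux)
    (hsol : IsWeakSolution ε b T u₀ u ux) (hug : HasDirichletData T u g₀ g₁)
    (hr₁ : MemL1L2 T r₁) (hr₂ : MemLp r₂ 2 (muTime T)) (hv₀ : IsLip v₀ (Icc 0 1))
    (hv : MemW1Inf T v vx) (hvsol : IsPerturbedSolution ε b T v vx r₁ r₂)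
    (hvinit : ∀ x ∈ Icc (0 : ℝ) 1, v 0 x = v₀ x) (hvg : HasDirichletData T v g₀ g₁) :
    IsHomogeneousSolution ε b T (fun x => u₀ x - v₀ x) (fun t x => u t x - v t x)
      (fun t x => ux t x - vx t x) r₁ r₂ where
  init := hu₀.1.sub (memLp_of_isLip hv₀)
  bounded := hsol.bounded.sub (memLp_top_of_isLip hv.lipschitz)
  memLp_dx := hu.memLp_dx.sub (hv.memLp_dx.mono_exponent le_top)
  weakDeriv := by
    filter_upwards [hu.weakDeriv, hv.weakDeriv] with t h1 h2
    exact h1.sub h2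
  trace := by
    filter_upwards [hug, hvg] with t h1 h2
    simpa using h1.sub h2
  memL1L2 := hr₁
  memLp_neg := hr₂
  equation := by
    intro θ h1 h2 h3 ψ
    have hu1 : Integrable (Function.uncurry u) (muCyl T) := hu.memLp.integrable one_le_two
    have hux1 : Integrable (Function.uncurry ux) (muCyl T) := hu.memLp_dx.integrable one_le_two
    have hv1 : Integrable (Function.uncurry v) (muCyl T) :=
      (memLp_top_of_isLip hv.lipschitz).integrable le_top
    have hvx1 : Integrable (Function.uncurry vx) (muCyl T) := hv.memLp_dx.integrable le_top
    have hd : Continuous (deriv (ψ : ℝ → ℝ)) := ψ.contDiff_one.continuous_deriv le_rfl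
    have hdc : HasCompactSupport (deriv (ψ : ℝ → ℝ)) := ψ.2.2.1.deriv
    have hθd : Continuous (deriv θ) := h1.continuous_deriv (by simp)
    have eu := hsol.equation (CylTest.ofProd h1 h2 h3 ψ)
    have ev := hvsol (CylTest.ofProd h1 h2 h3 ψ)
    have edt : ∀ t x, (CylTest.ofProd h1 h2 h3 ψ).dt t x = deriv θ t * ψ x := fun t x =>
      ((h1.differentiable (by simp) t).hasDerivAt.mul_const (ψ x)).deriv
    have edx : ∀ t x, (CylTest.ofProd h1 h2 h3 ψ).dx t x = θ t * deriv (ψ : ℝ → ℝ) x :=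
      fun t x => ((ψ.contDiff_one.differentiable one_ne_zero x).hasDerivAt.const_mul (θ t)).deriv
    have ev0 : ∀ t x, (CylTest.ofProd h1 h2 h3 ψ) t x = θ t * ψ x := fun t x => rfl
    have esl : ∀ t, (CylTest.ofProd h1 h2 h3 ψ).slice t = θ t • ψ := fun t => rfl
    simp only [edt, edx, ev0, esl, map_smul, smul_eq_mul] at eu ev
    obtain ⟨a1, a2, a3⟩ := integral_cyl_mul hu1 hθd h2.deriv ψ.continuous ψ.2.2.1
    obtain ⟨b1, b2, b3⟩ := integral_cyl_mul hu1 h1.continuous h2 hd hdc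
    obtain ⟨c1, c2, c3⟩ := integral_cyl_mul hux1 h1.continuous h2 hd hdc
    obtain ⟨a1', a2', a3'⟩ := integral_cyl_mul hv1 hθd h2.deriv ψ.continuous ψ.2.2.1
    obtain ⟨b1', b2', b3'⟩ := integral_cyl_mul hv1 h1.continuous h2 hd hdc
    obtain ⟨c1', c2', c3'⟩ := integral_cyl_mul hvx1 h1.continuous h2 hd hdc
    obtain ⟨d1, d2, d3⟩ := integral_cyl_mul hr₁.integrable h1.continuous h2 ψ.continuous ψ.2.2.1
    have f2 : Integrable (fun t => θ t * r₂ t ψ) (muTime T) := by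
      obtain ⟨C, hC⟩ := h2.exists_bound_of_continuous h1.continuous
      exact (integrable_apply hr₂ ψ).bdd_mul h1.continuous.aestronglyMeasurable
        (Eventually.of_forall hC)
    have e1 : (fun z : ℝ × ℝ => deriv θ z.1 * ψ z.2 * u z.1 z.2
        + θ z.1 * deriv (ψ : ℝ → ℝ) z.2 * (b * u z.1 z.2 - ε * ux z.1 z.2))
        = fun z => deriv θ z.1 * ψ z.2 * u z.1 z.2
          + (b * (θ z.1 * deriv (ψ : ℝ → ℝ) z.2 * u z.1 z.2)
          - ε * (θ z.1 * deriv (ψ : ℝ → ℝ) z.2 * ux z.1 z.2)) := by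
      ext z
      ring
    have e2 : (fun z : ℝ × ℝ => deriv θ z.1 * ψ z.2 * v z.1 z.2
        + θ z.1 * deriv (ψ : ℝ → ℝ) z.2 * (b * v z.1 z.2 - ε * vx z.1 z.2)
        + r₁ z.1 z.2 * (θ z.1 * ψ z.2))
        = fun z => deriv θ z.1 * ψ z.2 * v z.1 z.2
          + (b * (θ z.1 * deriv (ψ : ℝ → ℝ) z.2 * v z.1 z.2)
          - ε * (θ z.1 * deriv (ψ : ℝ → ℝ) z.2 * vx z.1 z.2))
          + θ z.1 * ψ z.2 * r₁ z.1 z.2 := by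
      ext z
      ring
    rw [e1, integral_add a1 ((b1.const_mul b).fun_sub (c1.const_mul ε)),
      integral_sub (b1.const_mul b) (c1.const_mul ε), integral_const_mul, integral_const_mul,
      a3, b3, c3] at eu
    rw [e2, integral_add (a1'.fun_add ((b1'.const_mul b).fun_sub (c1'.const_mul ε))) d1,
      integral_add a1' ((b1'.const_mul b).fun_sub (c1'.const_mul ε)),
      integral_sub (b1'.const_mul b) (c1'.const_mul ε), integral_const_mul, integral_const_mul,
      a3', b3', c3', d3] at ev
    have hui : ∀ᵐ t ∂(muTime T), Integrable (u t) muOm :=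
      (ae_memLp_slice hu.memLp).mono fun t ht => integrable_of_memLp ht
    have huxi : ∀ᵐ t ∂(muTime T), Integrable (ux t) muOm :=
      hu.weakDeriv.mono fun t ht => ht.integrable_deriv
    have hvi : ∀ᵐ t ∂(muTime T), Integrable (v t) muOm :=
      hv.weakDeriv.mono fun t ht => ht.integrable
    have hvxi : ∀ᵐ t ∂(muTime T), Integrable (vx t) muOm :=
      hv.weakDeriv.mono fun t ht => ht.integrable_deriv
    have hsubx : ∀ {f g k : ℝ → ℝ}, Integrable f muOm → Integrable g muOm → Continuous k →
        ∫ x in Om, (f x - g x) * k x = (∫ x in Om, f x * k x) - ∫ x in Om, g x * k x := by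
      intro f g k hf hg hk
      simp only [sub_mul]
      exact integral_sub (integrable_mul_continuous hf hk) (integrable_mul_continuous hg hk)
    have e3 : ∫ t in Ioo 0 T, (deriv θ t * (∫ x in Om, (u t x - v t x) * ψ x)
        + θ t * flux ε b (fun t x => u t x - v t x) (fun t x => ux t x - vx t x) r₁ r₂ ψ t)
        = ∫ t in Ioo 0 T, ((deriv θ t * (∫ x in Om, u t x * ψ x)
            - deriv θ t * ∫ x in Om, v t x * ψ x)
          + ((b * (θ t * ∫ x in Om, u t x * deriv (ψ : ℝ → ℝ) x)
            - b * (θ t * ∫ x in Om, v t x * deriv (ψ : ℝ → ℝ) x))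
          - (ε * (θ t * ∫ x in Om, ux t x * deriv (ψ : ℝ → ℝ) x)
            - ε * (θ t * ∫ x in Om, vx t x * deriv (ψ : ℝ → ℝ) x)))
          - (θ t * (∫ x in Om, r₁ t x * ψ x) + ε * (θ t * r₂ t ψ))) := by
      refine integral_congr_ae ?_
      filter_upwards [hui, huxi, hvi, hvxi] with t k1 k2 k3 k4
      rw [flux, hsubx k1 k3 ψ.continuous, hsubx k1 k3 hd, hsubx k2 k4 hd]
      ring
    have e4 : ∫ x in Om, (u₀ x - v₀ x) * ψ x
        = (∫ x in Om, u₀ x * ψ x) - ∫ x in Om, v₀ x * ψ x :=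
      hsubx (integrable_of_memLp hu₀.1) (integrable_of_memLp (memLp_of_isLip hv₀)) ψ.continuous
    have e5 : ∫ x in Om, v 0 x * (θ 0 * ψ x) = θ 0 * ∫ x in Om, v₀ x * ψ x := by
      rw [← integral_const_mul]
      refine setIntegral_congr_fun measurableSet_Ioo fun x hx => ?_
      simp only [hvinit x (Ioo_subset_Icc_self hx)]
      ring
    have e6 : ∫ x in Om, u₀ x * (θ 0 * ψ x) = θ 0 * ∫ x in Om, u₀ x * ψ x := by
      rw [← integral_const_mul]
      congr 1
      ext x
      ring
    rw [e5] at ev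
    rw [e6] at eu
    rw [e3, e4, integral_sub, integral_add, integral_add, integral_sub, integral_sub,
      integral_sub, integral_sub]
    · simp only [integral_const_mul]
      linarith
    · exact c2.const_mul ε
    · exact c2'.const_mul ε
    · exact b2.const_mul b
    · exact b2'.const_mul b
    · exact (b2.const_mul b).fun_sub (b2'.const_mul b)
    · exact (c2.const_mul ε).fun_sub (c2'.const_mul ε)
    · exact a2
    · exact a2'
    · exact d2
    · exact f2.const_mul ε
    · exact a2.fun_sub a2'
    · exact ((b2.const_mul b).fun_sub (b2'.const_mul b)).fun_sub ((c2.const_mul ε).fun_sub (c2'.const_mul ε))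
    · exact (a2.fun_sub a2').fun_add
        (((b2.const_mul b).fun_sub (b2'.const_mul b)).fun_sub ((c2.const_mul ε).fun_sub (c2'.const_mul ε)))
    · exact d2.fun_add (f2.const_mul ε)

/-! ### Evolution of the sine modes. -/

theorem aestronglyMeasurable_integral_mul {T : ℝ} {f : ℝ → ℝ → ℝ}
    (hf : AEStronglyMeasurable (Function.uncurry f) (muCyl T)) {g : ℝ → ℝ} (hg : Continuous g) :
    AEStronglyMeasurable (fun t => ∫ x in Om, f t x * g x) (muTime T) := by
  rw [muCyl_eq_prod] at hf
  exact AEStronglyMeasurable.integral_prod_right' (f := fun z : ℝ × ℝ => f z.1 z.2 * g z.2)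
    (hf.mul (hg.comp continuous_snd).aestronglyMeasurable)

/-- The right-hand side of the equation tested with `sin (n π x)`, where `G` represents `r₂`. -/
noncomputable def sinFlux (ε b : ℝ) (w wx r₁ G : ℝ → ℝ → ℝ) (n : ℤ) (t : ℝ) : ℝ :=
  b * (n * Real.pi * cosCoeff (w t) n) - ε * (n * Real.pi * cosCoeff (wx t) n)
    - sinCoeff (r₁ t) n - ε * (n * Real.pi * cosCoeff (G t) n)

namespace IsHomogeneousSolution

variable {ε b T : ℝ} {w₀ : ℝ → ℝ} {w wx r₁ : ℝ → ℝ → ℝ} {r₂ : ℝ → HNegOne}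

theorem memLp (h : IsHomogeneousSolution ε b T w₀ w wx r₁ r₂) :
    MemLp (Function.uncurry w) 2 (muCyl T) := h.bounded.mono_exponent le_top

/-- An integrable bound for the right-hand side. -/
noncomputable def bound (ε b : ℝ) (w wx r₁ : ℝ → ℝ → ℝ) (r₂ : ℝ → HNegOne) (t : ℝ) : ℝ :=
  |b| * nrm (w t) + |ε| * nrm (wx t) + nrm (r₁ t) + |ε| * ‖r₂ t‖

theorem integrable_bound (h : IsHomogeneousSolution ε b T w₀ w wx r₁ r₂) :
    Integrable (bound ε b w wx r₁ r₂) (muTime T) :=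
  (((((memLp_nrm h.memLp).integrable one_le_two).const_mul |b|).fun_add
    (((memLp_nrm h.memLp_dx).integrable one_le_two).const_mul |ε|)).fun_add
    h.memL1L2.integrable_nrm).fun_add
    (((memLp_norm h.memLp_neg).integrable one_le_two).const_mul |ε|)

/-- The exceptional null set of times does not depend on `ψ`, so one integrable majorant serves a
whole sequence of test functions that is bounded in norm. -/
theorem abs_flux_le (h : IsHomogeneousSolution ε b T w₀ w wx r₁ r₂) :
    ∀ᵐ t ∂(muTime T), ∀ ψ : TestFn,
      |flux ε b w wx r₁ r₂ ψ t| ≤ bound ε b w wx r₁ r₂ t * ‖ψ‖ := by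
  filter_upwards [ae_memLp_slice h.memLp, ae_memLp_slice h.memLp_dx, h.memL1L2.ae_memLp]
    with t h1 h2 h3 ψ
  have k1 := abs_integral_mul_le h1 ψ.memLp_deriv
  have k2 := abs_integral_mul_le h2 ψ.memLp_deriv
  have k3 := (abs_integral_mul_le h3 (ψ.memLp 2)).trans
    (mul_le_mul_of_nonneg_left ψ.nrm_le_norm (nrm_nonneg _))
  have k4 : |r₂ t ψ| ≤ ‖r₂ t‖ * ‖ψ‖ := (r₂ t).le_opNorm ψ
  rw [← ψ.norm_eq] at k1 k2
  have l1 := mul_le_mul_of_nonneg_left k1 (abs_nonneg b)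
  have l2 := mul_le_mul_of_nonneg_left k2 (abs_nonneg ε)
  have l4 := mul_le_mul_of_nonneg_left k4 (abs_nonneg ε)
  rw [flux, bound]
  rw [← abs_mul] at l1 l2 l4
  refine (abs_sub _ _).trans ?_
  have m1 := abs_sub (b * (∫ x in Om, w t x * deriv (ψ : ℝ → ℝ) x)
    - ε * (∫ x in Om, wx t x * deriv (ψ : ℝ → ℝ) x)) (∫ x in Om, r₁ t x * ψ x)
  have m2 := abs_sub (b * (∫ x in Om, w t x * deriv (ψ : ℝ → ℝ) x))
    (ε * (∫ x in Om, wx t x * deriv (ψ : ℝ → ℝ) x))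
  linarith

theorem aestronglyMeasurable_flux (h : IsHomogeneousSolution ε b T w₀ w wx r₁ r₂) (ψ : TestFn) :
    AEStronglyMeasurable (flux ε b w wx r₁ r₂ ψ) (muTime T) := by
  have hd : Continuous (deriv (ψ : ℝ → ℝ)) := ψ.contDiff_one.continuous_deriv le_rfl
  exact ((((aestronglyMeasurable_integral_mul h.memLp.1 hd).const_mul b).sub
    ((aestronglyMeasurable_integral_mul h.memLp_dx.1 hd).const_mul ε)).sub
    (aestronglyMeasurable_integral_mul h.memL1L2.1 ψ.continuous)).sub
    ((integrable_apply h.memLp_neg ψ).1.const_mul ε)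

/-- The equation tested with `θ(t) sin (n π x)`. -/
theorem sin_equation (h : IsHomogeneousSolution ε b T w₀ w wx r₁ r₂) {G : ℝ → ℝ → ℝ}
    (hG : ∀ t, MemLp (G t) 2 muOm)
    (hGr : ∀ t (φ : TestFn), r₂ t φ = ∫ x in Om, G t x * deriv (φ : ℝ → ℝ) x) (n : ℤ) :
    Integrable (fun t => sinCoeff (w t) n) (muTime T) ∧
    Integrable (sinFlux ε b w wx r₁ G n) (muTime T) ∧
    ∀ θ : ℝ → ℝ, ContDiff ℝ (⊤ : ℕ∞) θ → HasCompactSupport θ → tsupport θ ⊆ Iio T →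
      (∫ t in Ioo 0 T, (deriv θ t * sinCoeff (w t) n + θ t * sinFlux ε b w wx r₁ G n t))
        + θ 0 * sinCoeff w₀ n = 0 := by
  obtain ⟨ψ, ⟨C, hC⟩, hψd, hψ⟩ := exists_seq_tendsto_sin n
  have hKi := h.integrable_bound.mul_const C
  have hNi := ((memLp_nrm h.memLp).integrable one_le_two).mul_const C
  have hb0 : ∀ t, 0 ≤ bound ε b w wx r₁ r₂ t := fun t => by
    have := nrm_nonneg (w t)
    have := nrm_nonneg (wx t)
    have := nrm_nonneg (r₁ t)
    have := norm_nonneg (r₂ t)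
    unfold bound
    positivity
  have hlim : ∀ᵐ t ∂(muTime T), Tendsto (fun j => ∫ x in Om, w t x * ψ j x) atTop
      (𝓝 (sinCoeff (w t) n)) := (ae_memLp_slice h.memLp).mono fun t ht => hψ _ ht
  have hflim : ∀ᵐ t ∂(muTime T), Tendsto (fun j => flux ε b w wx r₁ r₂ (ψ j) t) atTop
      (𝓝 (sinFlux ε b w wx r₁ G n t)) := by
    filter_upwards [ae_memLp_slice h.memLp, ae_memLp_slice h.memLp_dx, h.memL1L2.ae_memLp]
      with t h1 h2 h3
    simp only [flux, hGr]
    exact ((((hψd _ h1).const_mul b).sub ((hψd _ h2).const_mul ε)).sub (hψ _ h3)).sub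
      ((hψd _ (hG t)).const_mul ε)
  have hbd : ∀ᵐ t ∂(muTime T), ∀ j, |∫ x in Om, w t x * ψ j x| ≤ nrm (w t) * C := by
    filter_upwards [ae_memLp_slice h.memLp] with t h1 j
    exact (abs_integral_mul_le h1 ((ψ j).memLp 2)).trans
      (mul_le_mul_of_nonneg_left ((ψ j).nrm_le_norm.trans (hC j)) (nrm_nonneg _))
  have hfbd : ∀ᵐ t ∂(muTime T), ∀ j, |flux ε b w wx r₁ r₂ (ψ j) t|
      ≤ bound ε b w wx r₁ r₂ t * C := by
    filter_upwards [h.abs_flux_le] with t ht j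
    exact (ht _).trans (mul_le_mul_of_nonneg_left (hC j) (hb0 t))
  have hm1 : ∀ j, AEStronglyMeasurable (fun t => ∫ x in Om, w t x * ψ j x) (muTime T) :=
    fun j => aestronglyMeasurable_integral_mul h.memLp.1 (ψ j).continuous
  refine ⟨?_, ?_, ?_⟩
  · refine hNi.mono' (aestronglyMeasurable_of_tendsto_ae atTop hm1 hlim) ?_
    filter_upwards [hlim, hbd] with t h1 h2
    exact le_of_tendsto h1.norm (Eventually.of_forall h2)
  -- `G` is given separately at each time, with no measurability in `t`. The measurability of
  -- `sinFlux` comes from its being a limit of fluxes tested with `ψ j`.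
  · refine hKi.mono' (aestronglyMeasurable_of_tendsto_ae atTop
      (fun j => h.aestronglyMeasurable_flux (ψ j)) hflim) ?_
    filter_upwards [hflim, hfbd] with t h1 h2
    exact le_of_tendsto h1.norm (Eventually.of_forall h2)
  · intro θ h1 h2 h3
    have hθd : Continuous (deriv θ) := h1.continuous_deriv (by simp)
    obtain ⟨A, hA⟩ := h2.deriv.exists_bound_of_continuous hθd
    obtain ⟨B, hB⟩ := h2.exists_bound_of_continuous h1.continuous
    have t1 : Tendsto (fun j => ∫ t in Ioo 0 T, (deriv θ t * (∫ x in Om, w t x * ψ j x)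
        + θ t * flux ε b w wx r₁ r₂ (ψ j) t)) atTop
        (𝓝 (∫ t in Ioo 0 T, (deriv θ t * sinCoeff (w t) n
          + θ t * sinFlux ε b w wx r₁ G n t))) := by
      refine tendsto_integral_of_dominated_convergence
        (fun t => A * (nrm (w t) * C) + B * (bound ε b w wx r₁ r₂ t * C)) (fun j => ?_)
        ((hNi.const_mul A).fun_add (hKi.const_mul B)) (fun j => ?_) ?_
      · exact (hθd.aestronglyMeasurable.mul (hm1 j)).add
          (h1.continuous.aestronglyMeasurable.mul (h.aestronglyMeasurable_flux (ψ j)))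
      · filter_upwards [hbd, hfbd] with t k1 k2
        refine (norm_add_le _ _).trans (add_le_add ?_ ?_)
        · rw [norm_mul]
          exact mul_le_mul (hA t) (k1 j) (norm_nonneg _) ((norm_nonneg _).trans (hA t))
        · rw [norm_mul]
          exact mul_le_mul (hB t) (k2 j) (norm_nonneg _) ((norm_nonneg _).trans (hB t))
      · filter_upwards [hlim, hflim] with t k1 k2
        exact (k1.const_mul _).add (k2.const_mul _)
    have t2 := t1.add ((hψ _ h.init).const_mul (θ 0))
    refine tendsto_nhds_unique t2 ?_
    simp only [h.equation θ h1 h2 h3]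
    exact tendsto_const_nhds

/-- The evolution of the squares of the sine coefficients. -/
theorem sq_sinCoeff_eq (hT : 0 < T) (h : IsHomogeneousSolution ε b T w₀ w wx r₁ r₂)
    {G : ℝ → ℝ → ℝ} (hG : ∀ t, MemLp (G t) 2 muOm)
    (hGr : ∀ t (φ : TestFn), r₂ t φ = ∫ x in Om, G t x * deriv (φ : ℝ → ℝ) x) (n : ℤ) :
    IntegrableOn (fun t => sinCoeff (w t) n * sinFlux ε b w wx r₁ G n t) (Ioo 0 T) ∧
    ∀ᵐ t ∂(muTime T), sinCoeff (w t) n ^ 2 = sinCoeff w₀ n ^ 2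
      + 2 * ∫ s in Ioo 0 t, sinCoeff (w s) n * sinFlux ε b w wx r₁ G n s := by
  obtain ⟨h1, h2, h3⟩ := h.sin_equation hG hGr n
  have hae := ae_eq_primitive_of_weak hT h1 h2 h3
  set F := sinFlux ε b w wx r₁ G n
  set c := sinCoeff w₀ n
  have hFT := intervalIntegrable_of_Ioo hT.le h2
  constructor
  · have hcont := continuousOn_primitive hFT c
    have := (hFT.continuousOn_mul hcont)
    rw [intervalIntegrable_iff_integrableOn_Ioo_of_le hT.le] at this
    refine this.congr ?_
    filter_upwards [hae] with t ht
    rw [ht]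
  · filter_upwards [hae, ae_restrict_mem measurableSet_Ioo] with t ht htm
    rw [ht]
    have hFt : IntervalIntegrable F volume 0 t :=
      intervalIntegrable_of_Ioo htm.1.le
        (IntegrableOn.mono_set h2 (Ioo_subset_Ioo_right htm.2.le))
    rw [sq_primitive hFt c, ← integral_Ioo_eq_interval htm.1.le]
    congr 2
    refine integral_congr_ae ?_
    have := ae_mono (Measure.restrict_mono (Ioo_subset_Ioo_right htm.2.le) le_rfl) hae
    filter_upwards [this] with s hs
    rw [hs]

end IsHomogeneousSolution

/-! ### The energy inequality. -/

namespace IsHomogeneousSolution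

variable {ε b T : ℝ} {w₀ : ℝ → ℝ} {w wx r₁ : ℝ → ℝ → ℝ} {r₂ : ℝ → HNegOne}

/-- The factor `n π` is moved onto the sine coefficient of `f`, which becomes a cosine coefficient
of `f'`. Cauchy-Schwarz then bounds the two source terms, and Young's inequality costs half of the
dissipation. -/
theorem sum_sinCoeff_mul_sinFlux_le (hε : 0 < ε) {f f' r G : ℝ → ℝ} (b : ℝ) (hf : MemLp f 2 muOm)
    (hd : IsWeakDeriv f f') (ht : HasTrace f 0 0) (hr : MemLp r 2 muOm)
    (hG : MemLp G 2 muOm) (s : Finset ℤ) :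
    ∑ n ∈ s, sinCoeff f n * (b * (n * Real.pi * cosCoeff f n) - ε * (n * Real.pi * cosCoeff f' n)
        - sinCoeff r n - ε * (n * Real.pi * cosCoeff G n))
      ≤ b * ∑ n ∈ s, cosCoeff f n * cosCoeff f' n - ε / 2 * ∑ n ∈ s, cosCoeff f' n ^ 2
        + nrm r * nrm f + ε / 2 * nrm G ^ 2 := by
  have e : ∑ n ∈ s, sinCoeff f n * (b * (n * Real.pi * cosCoeff f n)
        - ε * (n * Real.pi * cosCoeff f' n) - sinCoeff r n - ε * (n * Real.pi * cosCoeff G n))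
      = b * ∑ n ∈ s, cosCoeff f n * cosCoeff f' n - ε * ∑ n ∈ s, cosCoeff f' n ^ 2
        - ∑ n ∈ s, sinCoeff r n * sinCoeff f n - ε * ∑ n ∈ s, cosCoeff f' n * cosCoeff G n := by
    simp only [Finset.mul_sum, ← Finset.sum_sub_distrib]
    refine Finset.sum_congr rfl fun n _ => ?_
    rw [hd.cosCoeff_eq ht n]
    ring
  have h1 := abs_sum_mul_le s (sinCoeff r) (sinCoeff f) (nrm_nonneg r) (nrm_nonneg f)
    (sum_sinCoeff_sq_le hr s) (sum_sinCoeff_sq_le hf s)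
  have hS : 0 ≤ ∑ n ∈ s, cosCoeff f' n ^ 2 := Finset.sum_nonneg fun _ _ => sq_nonneg _
  -- The partial sum itself serves as the bound for `f'`, so that it is absorbed exactly by the
  -- dissipation over the same modes.
  have h2 := abs_sum_mul_le s (cosCoeff f') (cosCoeff G) (Real.sqrt_nonneg _) (nrm_nonneg G)
    (Real.sq_sqrt hS).ge (sum_cosCoeff_sq_le hG s)
  have h3 := two_mul_le_add_sq (√(∑ n ∈ s, cosCoeff f' n ^ 2)) (nrm G)
  rw [Real.sq_sqrt hS] at h3
  have h4 := (abs_le.1 h1).1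
  have h5 : -(∑ n ∈ s, cosCoeff f' n * cosCoeff G n)
      ≤ (∑ n ∈ s, cosCoeff f' n ^ 2 + nrm G ^ 2) / 2 := by
    linarith [(abs_le.1 h2).1]
  have h6 := mul_le_mul_of_nonneg_left h5 hε.le
  rw [e]
  linarith

theorem integrable_nrm_mul (h : IsHomogeneousSolution ε b T w₀ w wx r₁ r₂) :
    Integrable (fun t => nrm (r₁ t) * nrm (w t)) (muTime T) := by
  obtain ⟨C, _, hC⟩ := exists_nrm_le h.bounded
  refine h.memL1L2.integrable_nrm.mul_bdd (c := C) (memLp_nrm h.memLp).1 ?_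
  filter_upwards [hC] with t ht
  rwa [Real.norm_of_nonneg (nrm_nonneg _)]

/-- The energy inequality. -/
theorem energy_le (hε : 0 < ε) (hT : 0 < T) (h : IsHomogeneousSolution ε b T w₀ w wx r₁ r₂) :
    ∀ᵐ t ∂(muTime T), nrm (w t) ^ 2 / 2 + ε / 2 * ∫ s in Ioo 0 t, nrm (wx s) ^ 2
      ≤ nrm w₀ ^ 2 / 2 + (∫ s in Ioo 0 t, nrm (r₁ s) * nrm (w s))
        + ε / 2 * ∫ s in Ioo 0 t, ‖r₂ s‖ ^ 2 := by
  choose G hG hGn hGr using fun t => (r₂ t).exists_representation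
  have hsq := fun n => h.sq_sinCoeff_eq hT hG hGr n
  have hall := ae_all_iff.2 fun n => (hsq n).2
  have hmw : ∀ n : ℤ, AEStronglyMeasurable (fun t => cosCoeff (w t) n) (muTime T) := fun n =>
    aestronglyMeasurable_integral_mul h.memLp.1 (by fun_prop)
  have hmx : ∀ n : ℤ, AEStronglyMeasurable (fun t => cosCoeff (wx t) n) (muTime T) := fun n =>
    aestronglyMeasurable_integral_mul h.memLp_dx.1 (by fun_prop)
  have hmB : ∀ s : Finset ℤ, AEStronglyMeasurable
      (fun t => ∑ n ∈ s, cosCoeff (w t) n * cosCoeff (wx t) n) (muTime T) := fun s =>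
    Finset.aestronglyMeasurable_fun_sum s fun n _ => (hmw n).mul (hmx n)
  have hmS : ∀ s : Finset ℤ, AEStronglyMeasurable
      (fun t => ∑ n ∈ s, cosCoeff (wx t) n ^ 2) (muTime T) := fun s =>
    Finset.aestronglyMeasurable_fun_sum s fun n _ => (hmx n).pow 2
  have hiX := integrable_nrm_sq h.memLp_dx
  have hiW : Integrable (fun t => nrm (w t) * nrm (wx t)) (muTime T) :=
    MemLp.integrable_mul (memLp_nrm h.memLp) (memLp_nrm h.memLp_dx)
  have hiR : Integrable (fun t => ‖r₂ t‖ ^ 2) (muTime T) := (memLp_norm h.memLp_neg).integrable_sq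
  have hbB : ∀ s : Finset ℤ, ∀ᵐ t ∂(muTime T),
      ‖∑ n ∈ s, cosCoeff (w t) n * cosCoeff (wx t) n‖ ≤ nrm (w t) * nrm (wx t) := fun s => by
    filter_upwards [ae_memLp_slice h.memLp, ae_memLp_slice h.memLp_dx] with t h1 h2
    exact abs_sum_mul_le s _ _ (nrm_nonneg _) (nrm_nonneg _) (sum_cosCoeff_sq_le h1 s)
      (sum_cosCoeff_sq_le h2 s)
  have hbS : ∀ s : Finset ℤ, ∀ᵐ t ∂(muTime T),
      ‖∑ n ∈ s, cosCoeff (wx t) n ^ 2‖ ≤ nrm (wx t) ^ 2 := fun s => by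
    filter_upwards [ae_memLp_slice h.memLp_dx] with t h2
    rw [Real.norm_of_nonneg (Finset.sum_nonneg fun _ _ => sq_nonneg _)]
    exact sum_cosCoeff_sq_le h2 s
  -- Convection need not vanish on a finite set of modes. It does in the limit, where the sum is `∫
  -- w ∂_x w = 0`.
  have hlB : ∀ᵐ t ∂(muTime T), Tendsto
      (fun s : Finset ℤ => ∑ n ∈ s, cosCoeff (w t) n * cosCoeff (wx t) n) atTop (𝓝 0) := by
    filter_upwards [ae_memLp_slice h.memLp, ae_memLp_slice h.memLp_dx, h.weakDeriv, h.trace]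
      with t h1 h2 h3 h4
    have := hasSum_cosCoeff_mul h1 h2
    rwa [h3.integral_mul_self h4] at this
  have hlS : ∀ᵐ t ∂(muTime T), Tendsto
      (fun s : Finset ℤ => ∑ n ∈ s, cosCoeff (wx t) n ^ 2) atTop (𝓝 (nrm (wx t) ^ 2)) := by
    filter_upwards [ae_memLp_slice h.memLp_dx] with t h2
    rw [nrm_sq]
    exact hasSum_cosCoeff_sq h2
  have hpt : ∀ s : Finset ℤ, ∀ᵐ t ∂(muTime T),
      ∑ n ∈ s, sinCoeff (w t) n * sinFlux ε b w wx r₁ G n t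
        ≤ b * (∑ n ∈ s, cosCoeff (w t) n * cosCoeff (wx t) n)
          - ε / 2 * (∑ n ∈ s, cosCoeff (wx t) n ^ 2)
          + nrm (r₁ t) * nrm (w t) + ε / 2 * ‖r₂ t‖ ^ 2 := fun s => by
    filter_upwards [ae_memLp_slice h.memLp, ae_memLp_slice h.memLp_dx, h.weakDeriv, h.trace,
      h.memL1L2.ae_memLp] with t h1 h2 h3 h4 h5
    have k1 := sum_sinCoeff_mul_sinFlux_le hε b h1 h3 h4 h5 (hG t) s
    have k2 : nrm (G t) ^ 2 ≤ ‖r₂ t‖ ^ 2 := pow_le_pow_left₀ (nrm_nonneg _) (hGn t) 2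
    have k3 := mul_le_mul_of_nonneg_left k2 (half_pos hε).le
    exact k1.trans (by linarith)
  filter_upwards [hall, ae_memLp_slice h.memLp, ae_restrict_mem measurableSet_Ioo]
    with t ht hwt htm
  have hsub : Ioo 0 t ⊆ Ioo 0 T := Ioo_subset_Ioo_right htm.2.le
  have hle : muTime t ≤ muTime T := Measure.restrict_mono hsub le_rfl
  have hiB' : ∀ s : Finset ℤ, Integrable
      (fun t => ∑ n ∈ s, cosCoeff (w t) n * cosCoeff (wx t) n) (muTime t) := fun s =>
    (hiW.mono' (hmB s) (hbB s)).mono_measure hle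
  have hiS' : ∀ s : Finset ℤ, Integrable
      (fun t => ∑ n ∈ s, cosCoeff (wx t) n ^ 2) (muTime t) := fun s =>
    (hiX.mono' (hmS s) (hbS s)).mono_measure hle
  have tB : Tendsto (fun s : Finset ℤ => ∫ τ in Ioo 0 t, ∑ n ∈ s,
      cosCoeff (w τ) n * cosCoeff (wx τ) n) atTop (𝓝 0) := by
    -- Dominated convergence is available along finite sets of modes because `ℤ` is countable, which
    -- makes this filter countably generated.
    have := tendsto_integral_filter_of_dominated_convergence (μ := muTime t) (l := atTop)
      (F := fun (s : Finset ℤ) τ => ∑ n ∈ s, cosCoeff (w τ) n * cosCoeff (wx τ) n)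
      (f := fun _ => 0) (fun τ => nrm (w τ) * nrm (wx τ))
      (Eventually.of_forall fun s => (hiB' s).1)
      (Eventually.of_forall fun s => ae_mono hle (hbB s)) (hiW.mono_measure hle)
      (ae_mono hle hlB)
    simpa using this
  have tS : Tendsto (fun s : Finset ℤ => ∫ τ in Ioo 0 t, ∑ n ∈ s, cosCoeff (wx τ) n ^ 2) atTop
      (𝓝 (∫ τ in Ioo 0 t, nrm (wx τ) ^ 2)) :=
    tendsto_integral_filter_of_dominated_convergence (fun τ => nrm (wx τ) ^ 2)
      (Eventually.of_forall fun s => (hiS' s).1)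
      (Eventually.of_forall fun s => ae_mono hle (hbS s)) (hiX.mono_measure hle)
      (ae_mono hle hlS)
  have tW : Tendsto (fun s : Finset ℤ => ∑ n ∈ s, sinCoeff (w t) n ^ 2) atTop
      (𝓝 (nrm (w t) ^ 2)) := by
    rw [nrm_sq]
    exact hasSum_sinCoeff_sq hwt
  have hfin : ∀ s : Finset ℤ, (∑ n ∈ s, sinCoeff (w t) n ^ 2) / 2
      + ε / 2 * (∫ τ in Ioo 0 t, ∑ n ∈ s, cosCoeff (wx τ) n ^ 2)
      ≤ nrm w₀ ^ 2 / 2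
        + b * (∫ τ in Ioo 0 t, ∑ n ∈ s, cosCoeff (w τ) n * cosCoeff (wx τ) n)
        + (∫ s in Ioo 0 t, nrm (r₁ s) * nrm (w s))
        + ε / 2 * ∫ s in Ioo 0 t, ‖r₂ s‖ ^ 2 := by
    intro s
    have hint : ∀ n ∈ s, Integrable (fun τ => sinCoeff (w τ) n * sinFlux ε b w wx r₁ G n τ)
        (muTime t) := fun n _ => (hsq n).1.mono_set hsub
    have e1 : ∑ n ∈ s, sinCoeff (w t) n ^ 2 = ∑ n ∈ s, sinCoeff w₀ n ^ 2
        + 2 * ∫ τ in Ioo 0 t, ∑ n ∈ s, sinCoeff (w τ) n * sinFlux ε b w wx r₁ G n τ := by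
      rw [integral_finsetSum s hint, Finset.mul_sum, ← Finset.sum_add_distrib]
      exact Finset.sum_congr rfl fun n _ => ht n
    have i3 := h.integrable_nrm_mul.mono_measure hle
    have i4 := (hiR.mono_measure hle).const_mul (ε / 2)
    have i12 := ((hiB' s).const_mul b).fun_sub ((hiS' s).const_mul (ε / 2))
    have e2 := integral_mono_ae (integrable_finsetSum s hint) ((i12.fun_add i3).fun_add i4)
      (ae_mono hle (hpt s))
    rw [integral_add (i12.fun_add i3) i4, integral_add i12 i3,
      integral_sub ((hiB' s).const_mul b) ((hiS' s).const_mul (ε / 2)), integral_const_mul,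
      integral_const_mul, integral_const_mul] at e2
    have e3 := sum_sinCoeff_sq_le h.init s
    linarith
  have hlim := le_of_tendsto_of_tendsto' ((tW.div_const 2).add (tS.const_mul (ε / 2)))
    ((((tB.const_mul b).const_add (nrm w₀ ^ 2 / 2)).add_const _).add_const _) hfin
  simpa using hlim

end IsHomogeneousSolution

/-! ### From the energy inequality to the stated norms. -/

theorem eLpNorm_two_sq_eq_ofReal {α : Type*} {m : MeasurableSpace α} {μ : Measure α} {f : α → ℝ}
    (hf : MemLp f 2 μ) : eLpNorm f 2 μ ^ 2 = ENNReal.ofReal (∫ x, f x ^ 2 ∂μ) := by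
  rw [eLpNorm_two_sq, ofReal_integral_eq_lintegral_ofReal hf.integrable_sq
    (Eventually.of_forall fun _ => sq_nonneg _)]
  refine lintegral_congr fun x => ?_
  rw [← sq_abs, ENNReal.ofReal_pow (abs_nonneg _), ← Real.norm_eq_abs, ofReal_norm]

theorem muTime_mono {s t : ℝ} (h : s ≤ t) : muTime s ≤ muTime t :=
  Measure.restrict_mono (Ioo_subset_Ioo_right h) le_rfl

theorem muCyl_mono {s t : ℝ} (h : s ≤ t) : muCyl s ≤ muCyl t :=
  Measure.restrict_mono (prod_mono (Ioo_subset_Ioo_right h) subset_rfl) le_rfl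

theorem MemL1L2.mono {s t : ℝ} {r : ℝ → ℝ → ℝ} (hr : MemL1L2 t r) (h : s ≤ t) : MemL1L2 s r :=
  ⟨hr.1.mono_measure (muCyl_mono h),
    (eLpNorm_mono_measure _ (muTime_mono h)).trans_lt hr.norm_lt_top⟩

theorem MemL1L2.norm_eq {t : ℝ} {r : ℝ → ℝ → ℝ} (hr : MemL1L2 t r) :
    normLpL2 1 t r = ENNReal.ofReal (∫ s in Ioo 0 t, nrm (r s)) := by
  rw [normLpL2, eLpNorm_one_eq_lintegral_enorm,
    ofReal_integral_eq_lintegral_ofReal hr.integrable_nrm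
      (Eventually.of_forall fun _ => nrm_nonneg _)]
  refine lintegral_congr_ae ?_
  filter_upwards [hr.ae_memLp] with s hs
  rw [enorm_eq_self, eLpNorm_eq_nrm hs]

theorem normLpL2_top_le {t : ℝ} {w : ℝ → ℝ → ℝ} {C : ℝ}
    (hw : ∀ᵐ s ∂(muTime t), MemLp (w s) 2 muOm) (h : ∀ᵐ s ∂(muTime t), nrm (w s) ≤ C) :
    normLpL2 ∞ t w ≤ ENNReal.ofReal C := by
  rw [normLpL2, eLpNorm_exponent_top]
  refine essSup_le_of_ae_le _ ?_
  filter_upwards [hw, h] with s h1 h2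
  rw [enorm_eq_self, eLpNorm_eq_nrm h1]
  exact ENNReal.ofReal_le_ofReal h2

theorem ae_nrm_le {t : ℝ} {w : ℝ → ℝ → ℝ} (hw : ∀ᵐ s ∂(muTime t), MemLp (w s) 2 muOm)
    (h : normLpL2 ∞ t w ≠ ∞) : ∀ᵐ s ∂(muTime t), nrm (w s) ≤ (normLpL2 ∞ t w).toReal := by
  have := ae_le_eLpNormEssSup (f := fun s => eLpNorm (w s) 2 muOm) (μ := muTime t)
  filter_upwards [hw, this] with s h1 h2
  rw [enorm_eq_self, eLpNorm_eq_nrm h1] at h2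
  rw [normLpL2, eLpNorm_exponent_top] at h ⊢
  exact (ENNReal.ofReal_le_iff_le_toReal h).1 h2

theorem IsHomogeneousSolution.norm_le {ε b T : ℝ} {w₀ : ℝ → ℝ} {w wx r₁ : ℝ → ℝ → ℝ}
    {r₂ : ℝ → HNegOne} (hε : 0 < ε) (hT : 0 < T)
    (h : IsHomogeneousSolution ε b T w₀ w wx r₁ r₂) :
    ∀ᵐ t ∂(muTime T), 1 / 4 * normLpL2 ∞ t w ^ 2
        + ENNReal.ofReal (ε / 2) * eLpNorm (fun z : ℝ × ℝ => wx z.1 z.2) 2 (muCyl t) ^ 2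
      ≤ eLpNorm w₀ 2 muOm ^ 2 + 4 * normLpL2 1 t r₁ ^ 2
        + ENNReal.ofReal ε * eLpNorm r₂ 2 (muTime t) ^ 2 := by
  obtain ⟨C, hC0, hC⟩ := exists_nrm_le h.bounded
  have hen := h.energy_le hε hT
  filter_upwards [hen, ae_restrict_mem measurableSet_Ioo] with t ht htm
  have hle : muTime t ≤ muTime T := muTime_mono htm.2.le
  have hwm := ae_mono hle (ae_memLp_slice h.memLp)
  have hfin : normLpL2 ∞ t w ≠ ∞ :=
    ((normLpL2_top_le hwm (ae_mono hle hC)).trans_lt ENNReal.ofReal_lt_top).ne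
  set A := (normLpL2 ∞ t w).toReal with hA
  have hA0 : 0 ≤ A := ENNReal.toReal_nonneg
  have hAn : normLpL2 ∞ t w = ENNReal.ofReal A := (ENNReal.ofReal_toReal hfin).symm
  have hwA := ae_nrm_le hwm hfin
  have hr := h.memL1L2.mono htm.2.le
  have hr2 : MemLp r₂ 2 (muTime t) := h.memLp_neg.mono_measure hle
  have hx : MemLp (Function.uncurry wx) 2 (muCyl t) := h.memLp_dx.mono_measure (muCyl_mono htm.2.le)
  set R := ∫ s in Ioo 0 t, nrm (r₁ s) with hR
  set Q := ∫ s in Ioo 0 t, ‖r₂ s‖ ^ 2 with hQ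
  set D := ∫ s in Ioo 0 t, nrm (wx s) ^ 2 with hD
  have hR0 : 0 ≤ R := integral_nonneg fun _ => nrm_nonneg _
  have hQ0 : 0 ≤ Q := integral_nonneg fun _ => sq_nonneg _
  have hD0 : 0 ≤ D := integral_nonneg fun _ => sq_nonneg _
  have hRA : ∫ s in Ioo 0 t, nrm (r₁ s) * nrm (w s) ≤ R * A := by
    rw [hR, ← integral_mul_const]
    refine integral_mono_ae (h.integrable_nrm_mul.mono_measure hle)
      (hr.integrable_nrm.mul_const A) ?_
    filter_upwards [hwA] with s hs
    exact mul_le_mul_of_nonneg_left hs (nrm_nonneg _)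
  -- `K` bounds the right-hand side of the energy inequality at almost every time before `t`, and
  -- also at `t`. It contains `A`, the supremum being estimated.
  set K := nrm w₀ ^ 2 / 2 + R * A + ε / 2 * Q with hK
  have hK0 : 0 ≤ K := by positivity
  have hws : ∀ᵐ s ∂(muTime t), nrm (w s) ≤ √(2 * K) := by
    filter_upwards [ae_mono hle hen, ae_restrict_mem measurableSet_Ioo] with s hs hsm
    have hls : muTime s ≤ muTime t := muTime_mono hsm.2.le
    have k1 : ∫ τ in Ioo 0 s, nrm (r₁ τ) * nrm (w τ) ≤ R * A :=
      (integral_mono_measure hls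
        (Eventually.of_forall fun τ => mul_nonneg (nrm_nonneg _) (nrm_nonneg _))
        (h.integrable_nrm_mul.mono_measure hle)).trans hRA
    have k2 : ∫ τ in Ioo 0 s, ‖r₂ τ‖ ^ 2 ≤ Q :=
      integral_mono_measure hls (Eventually.of_forall fun τ => sq_nonneg _)
        (memLp_norm hr2).integrable_sq
    have k3 : 0 ≤ ∫ τ in Ioo 0 s, nrm (wx τ) ^ 2 := integral_nonneg fun _ => sq_nonneg _
    have k4 := mul_le_mul_of_nonneg_left k2 (half_pos hε).le
    have k5 := mul_nonneg (half_pos hε).le k3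
    apply Real.le_sqrt_of_sq_le
    linarith
  have hAK : A ^ 2 ≤ 2 * K := by
    have : A ≤ √(2 * K) :=
      ENNReal.toReal_le_of_le_ofReal (Real.sqrt_nonneg _) (normLpL2_top_le hwm hws)
    exact (Real.le_sqrt hA0 (by positivity)).1 this
  have hDK : ε / 2 * D ≤ K := by
    have := sq_nonneg (nrm (w t))
    linarith
  -- Adding `A² / 2 ≤ K` and `ε D / 2 ≤ K` leaves `2 R A` on the right. The bound `2 R A ≤ A² / 4 +
  -- 4 R²` absorbs it, whence the constants `1/4` and `4`.
  have hfinal : 1 / 4 * A ^ 2 + ε / 2 * D ≤ nrm w₀ ^ 2 + 4 * R ^ 2 + ε * Q := by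
    nlinarith [sq_nonneg (A / 2 - 2 * R)]
  have hxn : eLpNorm (fun z : ℝ × ℝ => wx z.1 z.2) 2 (muCyl t) ^ 2 = ENNReal.ofReal D := by
    rw [hD, integral_nrm_sq hx]
    exact eLpNorm_two_sq_eq_ofReal hx
  have hrn : eLpNorm r₂ 2 (muTime t) ^ 2 = ENNReal.ofReal Q := by
    rw [← eLpNorm_norm_eq, eLpNorm_two_sq_eq_ofReal (memLp_norm hr2)]
  rw [hAn, hxn, hrn, hr.norm_eq, eLpNorm_eq_nrm h.init, ← ENNReal.ofReal_pow hA0,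
    ← ENNReal.ofReal_pow (nrm_nonneg _), ← ENNReal.ofReal_pow hR0,
    ← ENNReal.ofReal_mul (half_pos hε).le, ← ENNReal.ofReal_mul hε.le,
    show (1 / 4 : ℝ≥0∞) = ENNReal.ofReal (1 / 4) by
      rw [ENNReal.ofReal_div_of_pos (by norm_num)]; simp,
    show (4 : ℝ≥0∞) = ENNReal.ofReal 4 by simp,
    ← ENNReal.ofReal_mul (by norm_num), ← ENNReal.ofReal_mul (by norm_num),
    ← ENNReal.ofReal_add (by positivity) (by positivity),
    ← ENNReal.ofReal_add (by positivity) (by positivity),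
    ← ENNReal.ofReal_add (by positivity) (by positivity)]
  exact ENNReal.ofReal_le_ofReal hfinal

end AdvDiff

theorem mainTheorem3
    (ε b T : ℝ) (hε : 0 < ε) (hT : 0 < T)
    -- Dirichlet boundary data at `x = 0` and `x = 1`
    (g₀ g₁ : ℝ → ℝ) (hg₀ : AdvDiff.IsLip g₀ (Set.Icc 0 T)) (hg₁ : AdvDiff.IsLip g₁ (Set.Icc 0 T))
    -- the entropy solution
    (u₀ : ℝ → ℝ) (hu₀ : AdvDiff.MemH1 u₀)
    (u ux : ℝ → ℝ → ℝ) (hu : AdvDiff.MemL2H1 T u ux)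
    (hsol : AdvDiff.IsEntropySolution ε b (fun y => y ^ 2 / 2) (fun y => b / 2 * y ^ 2) T u₀ u ux)
    (hug : AdvDiff.HasDirichletData T u g₀ g₁)
    -- the residual
    (r₁ : ℝ → ℝ → ℝ) (hr₁ : AdvDiff.MemL1L2 T r₁)
    (r₂ : ℝ → AdvDiff.HNegOne) (hr₂ : MeasureTheory.MemLp r₂ 2 (AdvDiff.muTime T))
    -- the Lipschitz solution of the perturbed equation; `vx` is its weak space derivative
    (v₀ : ℝ → ℝ) (hv₀ : AdvDiff.IsLip v₀ (Set.Icc 0 1))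
    (v vx : ℝ → ℝ → ℝ)
    (hv : AdvDiff.MemW1Inf T v vx)
    (hvsol : AdvDiff.IsPerturbedSolution ε b T v vx r₁ r₂)
    (hvinit : ∀ x ∈ Set.Icc (0 : ℝ) 1, v 0 x = v₀ x)
    (hvg : AdvDiff.HasDirichletData T v g₀ g₁) :
    ∀ᵐ t ∂(AdvDiff.muTime T),
      1 / 4 * AdvDiff.normLpL2 ∞ t (fun s x => u s x - v s x) ^ 2
        + ENNReal.ofReal (ε / 2)
          * MeasureTheory.eLpNorm (fun z : ℝ × ℝ => ux z.1 z.2 - vx z.1 z.2) 2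
              (AdvDiff.muCyl t) ^ 2
      ≤ MeasureTheory.eLpNorm (fun x => u₀ x - v₀ x) 2 AdvDiff.muOm ^ 2
        + 4 * AdvDiff.normLpL2 1 t r₁ ^ 2
        + ENNReal.ofReal ε * MeasureTheory.eLpNorm r₂ 2 (AdvDiff.muTime t) ^ 2 := by
  have h := AdvDiff.isHomogeneousSolution_sub hu₀ hu hsol.toIsWeakSolution hug hr₁ hr₂ hv₀ hv
    hvsol hvinit hvg
  have key := h.norm_le hε hT
  exact key
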